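/- Let $\alpha_0,\alpha_1,\alpha_2>-1$ be real numbers with $\alpha_1-\alpha_2\notin\mathbb Z$. For $n,m\ge 0$ the Jacobi--Piñeiro polynomial $P_{n,m}$ is the monic polynomial of degree $n+m$ such that $$\int_0^1 P_{n,m}(x)\,x^{\alpha_1+k}(1-x)^{\alpha_0}\,dx=0\quad(0\le k<n),\qquad \int_0^1 P_{n,m}(x)\,x^{\alpha_2+k}(1-x)^{\alpha_0}\,dx=0\quad(0\le k<m).$$ Put $P_{2n}=P_{n,n}$, $P_{2n+1}=P_{n+1,n}$ for $n\ge 0$, and $P_{-1}=P_{-2}=0$. Then these polynomials exist and are unique, and there are unique real sequences $(b_n),(c_n),(d_n)_{n\ge0}$, with the convention $c_0=d_0=d_1=0$, such that for all $n\ge 0$ $$xP_n(x)=P_{n+1}(x)+b_nP_n(x)+c_nP_{n-1}(x)+d_nP_{n-2}(x).$$ For every $n\ge 0$ for which the denominator on the right-hand side is nonzero (which is automatic for $n\ge1$ in the formulas for $b_{2n},b_{2n+1},c_{2n},c_{2n+1},d_{2n+1}$ and for $n\ge2$ in the formula for $d_{2n}$), they are given by $$b_{2n}=\frac{N_1}{D_1},\quad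 b_{2n+1}=\frac{N_2}{D_2},\quad c_{2n}=\frac{N_3}{D_3},\quad c_{2n+1}=\frac{N_4}{D_4},\quad d_{2n}=\frac{N_5}{D_5},\quad d_{2n+1}=\frac{N_6}{D_6},$$ where $$N_1=36n^4+(48\alpha_0+28\alpha_1+20\alpha_2+38)n^3+(21\alpha_0^{2}+8\alpha_1^{2}+4\alpha_2^{2}+30\alpha_0\alpha_1+18\alpha_0\alpha_2+15\alpha_1\alpha_2+39\alpha_0+19\alpha_1+19\alpha_2+9)n^2+(3\alpha_0^{3}+10\alpha_0^{2}\alpha_1+4\alpha_0^{2}\alpha_2+6\alpha_0\alpha_1^{2}+2\alpha_0\alpha_2^{2}+11\alpha_0\alpha_1\alpha_2+5\alpha_1^{2}\alpha_2+3\alpha_1\alpha_2^{2}+12\alpha_0^{2}+3\alpha_1^{2}+3\alpha_2^{2}+13\alpha_0\alpha_1+13\alpha_0\alpha_2+8\alpha_1\alpha_2+6\alpha_0+3\alpha_1+3\alpha_2)n+\alpha_0^{2}+\alpha_0\alpha_1+\alpha_2\alpha_1^{2}+2\alpha_2\alpha_1^{2}\alpha_0+2\alpha_0^{2}\alpha_1+\alpha_1^{2}\alpha_0+\alpha_2^{2}\alpha_0+\alpha_2^{2}\alpha_1+\alpha_0^{3}\alpha_1+\alpha_0^{2}\alpha_1^{2}+\alpha_2^{2}\alpha_0\alpha_1+\alpha_2^{2}\alpha_1^{2}+2\alpha_2\alpha_0^{2}\alpha_1+3\alpha_2\alpha_1\alpha_0+2\alpha_2\alpha_0^{2}+\alpha_1\alpha_2+\alpha_0^{3}+\alpha_0\alpha_2,$$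 $$D_1=(3n+\alpha_0+\alpha_2)(3n+\alpha_0+\alpha_1)(3n+\alpha_0+\alpha_2+1)(3n+\alpha_0+\alpha_1+2),$$ $$N_2=36n^4+(48\alpha_0+20\alpha_1+28\alpha_2+106)n^3+(21\alpha_0^{2}+4\alpha_1^{2}+8\alpha_2^{2}+18\alpha_0\alpha_1+30\alpha_0\alpha_2+15\alpha_1\alpha_2+105\alpha_0+41\alpha_1+65\alpha_2+111)n^2+(3\alpha_0^{3}+4\alpha_0^{2}\alpha_1+10\alpha_0^{2}\alpha_2+2\alpha_0\alpha_1^{2}+6\alpha_0\alpha_2^{2}+11\alpha_0\alpha_1\alpha_2+3\alpha_1^{2}\alpha_2+5\alpha_1\alpha_2^{2}+30\alpha_0^{2}+5\alpha_1^{2}+13\alpha_2^{2}+23\alpha_0\alpha_1+47\alpha_0\alpha_2+22\alpha_1\alpha_2+72\alpha_0+25\alpha_1+49\alpha_2+48)n+18\alpha_0\alpha_2+8\alpha_2\alpha_0^{2}+4\alpha_1+4\alpha_2^{2}\alpha_1+8\alpha_1\alpha_2+2\alpha_0^{3}+5\alpha_2^{2}\alpha_0+8\alpha_2\alpha_1\alpha_0+12\alpha_2+7+15\alpha_0+\alpha_2^{2}\alpha_1^{2}+10\alpha_0^{2}+6\alpha_0\alpha_1+2\alpha_2\alpha_1^{2}+2\alpha_0^{2}\alpha_1+\alpha_1^{2}\alpha_0+5\alpha_2^{2}+\alpha_2\alpha_0^{3}+\alpha_2^{2}\alpha_0^{2}+\alpha_1^{2}+\alpha_2\alpha_1^{2}\alpha_0+2\alpha_2\alpha_0^{2}\alpha_1+2\alpha_2^{2}\alpha_0\alpha_1,$$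 $$D_2=(3n+\alpha_0+\alpha_2+1)(3n+\alpha_0+\alpha_1+2)(3n+\alpha_0+\alpha_2+3)(3n+\alpha_0+\alpha_1+3),$$ $$N_3=n(2n+\alpha_0)(2n+\alpha_0+\alpha_1)(2n+\alpha_0+\alpha_2)(54n^4+(63\alpha_0+45\alpha_1+45\alpha_2)n^3+(24\alpha_0^{2}+8\alpha_1^{2}+8\alpha_2^{2}+42\alpha_0\alpha_1+42\alpha_0\alpha_2+44\alpha_1\alpha_2-8)n^2+(3\alpha_0^{3}+\alpha_1^{3}+\alpha_2^{3}+12\alpha_0^{2}\alpha_1+12\alpha_0^{2}\alpha_2+3\alpha_0\alpha_1^{2}+3\alpha_0\alpha_2^{2}+33\alpha_0\alpha_1\alpha_2+8\alpha_1^{2}\alpha_2+8\alpha_1\alpha_2^{2}-3\alpha_0-4\alpha_1-4\alpha_2)n+\alpha_0^{3}\alpha_1+\alpha_0^{3}\alpha_2+6\alpha_0^{2}\alpha_1\alpha_2+\alpha_1^{3}\alpha_2+\alpha_1\alpha_2^{3}+3\alpha_0\alpha_1^{2}\alpha_2+3\alpha_0\alpha_1\alpha_2^{2}-\alpha_0\alpha_1-\alpha_0\alpha_2-2\alpha_1\alpha_2),$$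 $$D_3=(3n+\alpha_0+\alpha_1+1)(3n+\alpha_0+\alpha_2+1)(3n+\alpha_0+\alpha_1)^2(3n+\alpha_0+\alpha_2)^2(3n+\alpha_0+\alpha_1-1)(3n+\alpha_0+\alpha_2-1),$$ $$N_4=(2n+\alpha_0+1)(2n+\alpha_0+\alpha_1+1)(2n+\alpha_0+\alpha_2+1)(54n^5+(63\alpha_0+45\alpha_1+45\alpha_2+135)n^4+(24\alpha_0^{2}+8\alpha_1^{2}+8\alpha_2^{2}+42\alpha_0\alpha_1+42\alpha_0\alpha_2+44\alpha_1\alpha_2+126\alpha_0+76\alpha_1+104\alpha_2+120)n^3+(3\alpha_0^{3}+\alpha_1^{3}+\alpha_2^{3}+12\alpha_0^{2}\alpha_1+12\alpha_0^{2}\alpha_2+3\alpha_0\alpha_1^{2}+3\alpha_0\alpha_2^{2}+33\alpha_0\alpha_1\alpha_2+8\alpha_1^{2}\alpha_2+8\alpha_1\alpha_2^{2}+36\alpha_0^{2}+5\alpha_1^{2}+19\alpha_2^{2}+54\alpha_0\alpha_1+72\alpha_0\alpha_2+66\alpha_1\alpha_2+87\alpha_0+39\alpha_1+81\alpha_2+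45)n^2+(\alpha_0^{3}\alpha_1+\alpha_0^{3}\alpha_2+6\alpha_0^{2}\alpha_1\alpha_2+\alpha_1^{3}\alpha_2+\alpha_1\alpha_2^{3}+3\alpha_0\alpha_1^{2}\alpha_2+3\alpha_0\alpha_1\alpha_2^{2}+3\alpha_0^{3}+2\alpha_2^{3}+12\alpha_0^{2}\alpha_1+12\alpha_0^{2}\alpha_2+6\alpha_0\alpha_2^{2}+33\alpha_0\alpha_1\alpha_2+5\alpha_1^{2}\alpha_2+11\alpha_1\alpha_2^{2}+18\alpha_0^{2}+20\alpha_0\alpha_1+38\alpha_0\alpha_2+14\alpha_2^{2}+26\alpha_1\alpha_2+24\alpha_0+6\alpha_1+24\alpha_2+6)n+\alpha_0^{3}\alpha_1+3\alpha_0^{2}\alpha_1\alpha_2+3\alpha_0\alpha_1\alpha_2^{2}+\alpha_1\alpha_2^{3}+\alpha_0^{3}+\alpha_2^{3}+3\alpha_0^{2}\alpha_1+3\alpha_0^{2}\alpha_2+6\alpha_0\alpha_1\alpha_2+3\alpha_0\alpha_2^{2}+3\alpha_1\alpha_2^{2}+3\alpha_0^{2}+3\alpha_2^{2}+2\alpha_0\alpha_1+6\alpha_0\alpha_2+2\alpha_1\alpha_2+2\alpha_0+2\alpha_2),$$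 $$D_4=(3n+\alpha_0+\alpha_1+3)(3n+\alpha_0+\alpha_2+2)(3n+\alpha_0+\alpha_1+2)^2(3n+\alpha_0+\alpha_2+1)^2(3n+\alpha_0+\alpha_1+1)(3n+\alpha_0+\alpha_2),$$ $$N_5=n(2n+\alpha_0)(2n+\alpha_0-1)(2n+\alpha_0+\alpha_1)(2n+\alpha_0+\alpha_1-1)(2n+\alpha_0+\alpha_2)(2n+\alpha_0+\alpha_2-1)(n+\alpha_1)(n+\alpha_1-\alpha_2),$$ $$D_5=(3n+1+\alpha_0+\alpha_1)(3n+\alpha_0+\alpha_1)^2(3n+\alpha_0+\alpha_2)(3n-1+\alpha_0+\alpha_1)^2(3n-1+\alpha_0+\alpha_2)(3n-2+\alpha_0+\alpha_1)(3n-2+\alpha_0+\alpha_2),$$ $$N_6=n(2n+1+\alpha_0)(2n+\alpha_0)(2n+\alpha_0+\alpha_1)(2n+1+\alpha_0+\alpha_1)(2n+1+\alpha_0+\alpha_2)(2n+\alpha_0+\alpha_2)(n+\alpha_2)(n+\alpha_2-\alpha_1),$$ $$D_6=(3n+2+\alpha_0+\alpha_1)(3n+2+\alpha_0+\alpha_2)(3n+1+\alpha_0+\alpha_1)(3n+1+\alpha_0+\alpha_2)^2(3n+\alpha_0+\alpha_1)(3n+\alpha_0+\alpha_2)^2(3n-1+\alpha_0+\alpha_2).$$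 Moreover, without any exception (these are the same formulas after cancellation of common factors), $$b_0=\frac{\alpha_1+1}{\alpha_0+\alpha_1+2},\qquad b_1=\frac{(\alpha_1+1)(\alpha_0+\alpha_2+2)+(\alpha_2+2)(\alpha_0+\alpha_1+3)}{(\alpha_0+\alpha_1+3)(\alpha_0+\alpha_2+3)}-\frac{\alpha_1+1}{\alpha_0+\alpha_1+2},$$ $$c_1=\frac{(\alpha_0+1)(\alpha_1+1)}{(\alpha_0+\alpha_1+2)^2(\alpha_0+\alpha_1+3)},\qquad d_2=\frac{(\alpha_0+1)(\alpha_0+2)(\alpha_1+1)(\alpha_1-\alpha_2+1)}{(\alpha_0+\alpha_1+2)(\alpha_0+\alpha_1+3)^2(\alpha_0+\alpha_1+4)(\alpha_0+\alpha_2+3)}.$$ In particular, as $n\to\infty$, $$b_n\to\frac49,\qquad c_n\to\frac{16}{243},\qquad d_n\to\frac{64}{19683}.$$ -/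

import Mathlib

open Polynomial

namespace JacobiPineiro

/-- `p` is a Jacobi–Piñeiro polynomial with parameters `α₀`, `α = (α_1, …, α_r)` for the multi-index
`n = (n_1, …, n_r)`: it is monic of degree `n_1 + ⋯ + n_r`, and for every `i` it is orthogonal on
`[0, 1]` to `1, x, …, x ^ (n_i - 1)` for the weight `x ^ α_i * (1 - x) ^ α₀`. -/
def IsJacobiPineiro {r : ℕ} (α₀ : ℝ) (α : Fin r → ℝ) (n : Fin r → ℕ) (p : ℝ[X]) : Prop :=
  p.Monic ∧ p.natDegree = ∑ i, n i ∧
    ∀ i : Fin r, ∀ k : ℕ, k < n i →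
      ∫ x in (0 : ℝ)..1, p.eval x * x ^ α i * (1 - x) ^ α₀ * x ^ k = 0

/-- `P` is the nearly diagonal sequence of Jacobi–Piñeiro polynomials with two weights:
`P_{2n} = P_{n,n}` and `P_{2n+1} = P_{n+1,n}`. -/
def IsNearlyDiagonal (α₀ α₁ α₂ : ℝ) (P : ℕ → ℝ[X]) : Prop :=
  ∀ n : ℕ, IsJacobiPineiro α₀ ![α₁, α₂] ![n, n] (P (2 * n)) ∧
    IsJacobiPineiro α₀ ![α₁, α₂] ![n + 1, n] (P (2 * n + 1))

/-- The four-term recurrence `x P_n = P_{n+1} + b_n P_n + c_n P_{n-1} + d_n P_{n-2}` for all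
`n ≥ 0`, with `P_{-1} = P_{-2} = 0`; the immaterial coefficients `c_0, d_0, d_1` of these zero
polynomials are normalised to be `0`. -/
def FourTermRecurrence (P : ℕ → ℝ[X]) (b c d : ℕ → ℝ) : Prop :=
  c 0 = 0 ∧ d 0 = 0 ∧ d 1 = 0 ∧
    X * P 0 = P 1 + C (b 0) * P 0 ∧
    X * P 1 = P 2 + C (b 1) * P 1 + C (c 1) * P 0 ∧
    ∀ n : ℕ, X * P (n + 2) =
      P (n + 3) + C (b (n + 2)) * P (n + 2) + C (c (n + 2)) * P (n + 1) + C (d (n + 2)) * P n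

/-- Numerator of the formula for `b_{2n}`. -/
def bEvenNum (α₀ α₁ α₂ n : ℝ) : ℝ :=
  36*n^4 + (48*α₀ + 28*α₁ + 20*α₂ + 38)*n^3 + (21*α₀^2 + 8*α₁^2 + 4*α₂^2 + 30*α₀*α₁ + 18*α₀*α₂
    + 15*α₁*α₂ + 39*α₀ + 19*α₁ + 19*α₂ + 9)*n^2 + (3*α₀^3 + 10*α₀^2*α₁ + 4*α₀^2*α₂ + 6*α₀*α₁^2
    + 2*α₀*α₂^2 + 11*α₀*α₁*α₂ + 5*α₁^2*α₂ + 3*α₁*α₂^2 + 12*α₀^2 + 3*α₁^2 + 3*α₂^2 + 13*α₀*α₁ +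
    13*α₀*α₂ + 8*α₁*α₂ + 6*α₀ + 3*α₁ + 3*α₂)*n + α₀^2 + α₀*α₁ + α₂*α₁^2 + 2*α₂*α₁^2*α₀ +
    2*α₀^2*α₁ + α₁^2*α₀ + α₂^2*α₀ + α₂^2*α₁ + α₀^3*α₁ + α₀^2*α₁^2 + α₂^2*α₀*α₁ + α₂^2*α₁^2 +
    2*α₂*α₀^2*α₁ + 3*α₂*α₁*α₀ + 2*α₂*α₀^2 + α₁*α₂ + α₀^3 + α₀*α₂

/-- Denominator of the formula for `b_{2n}`. -/
def bEvenDen (α₀ α₁ α₂ n : ℝ) : ℝ :=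
  (3*n + α₀ + α₂) * (3*n + α₀ + α₁) * (3*n + α₀ + α₂ + 1) * (3*n + α₀ + α₁ + 2)

/-- Numerator of the formula for `b_{2n+1}`. -/
def bOddNum (α₀ α₁ α₂ n : ℝ) : ℝ :=
  36*n^4 + (48*α₀ + 20*α₁ + 28*α₂ + 106)*n^3 + (21*α₀^2 + 4*α₁^2 + 8*α₂^2 + 18*α₀*α₁ +
    30*α₀*α₂ + 15*α₁*α₂ + 105*α₀ + 41*α₁ + 65*α₂ + 111)*n^2 + (3*α₀^3 + 4*α₀^2*α₁ + 10*α₀^2*α₂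
    + 2*α₀*α₁^2 + 6*α₀*α₂^2 + 11*α₀*α₁*α₂ + 3*α₁^2*α₂ + 5*α₁*α₂^2 + 30*α₀^2 + 5*α₁^2 + 13*α₂^2
    + 23*α₀*α₁ + 47*α₀*α₂ + 22*α₁*α₂ + 72*α₀ + 25*α₁ + 49*α₂ + 48)*n + 18*α₀*α₂ + 8*α₂*α₀^2 +
    4*α₁ + 4*α₂^2*α₁ + 8*α₁*α₂ + 2*α₀^3 + 5*α₂^2*α₀ + 8*α₂*α₁*α₀ + 12*α₂ + 7 + 15*α₀ +
    α₂^2*α₁^2 + 10*α₀^2 + 6*α₀*α₁ + 2*α₂*α₁^2 + 2*α₀^2*α₁ + α₁^2*α₀ + 5*α₂^2 + α₂*α₀^3 +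
    α₂^2*α₀^2 + α₁^2 + α₂*α₁^2*α₀ + 2*α₂*α₀^2*α₁ + 2*α₂^2*α₀*α₁

/-- Denominator of the formula for `b_{2n+1}`. -/
def bOddDen (α₀ α₁ α₂ n : ℝ) : ℝ :=
  (3*n + α₀ + α₂ + 1) * (3*n + α₀ + α₁ + 2) * (3*n + α₀ + α₂ + 3) * (3*n + α₀ + α₁ + 3)

/-- Numerator of the formula for `c_{2n}`. -/
def cEvenNum (α₀ α₁ α₂ n : ℝ) : ℝ :=
  n * (2*n + α₀) * (2*n + α₀ + α₁) * (2*n + α₀ + α₂) * (54*n^4 + (63*α₀ + 45*α₁ + 45*α₂)*n^3 +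
    (24*α₀^2 + 8*α₁^2 + 8*α₂^2 + 42*α₀*α₁ + 42*α₀*α₂ + 44*α₁*α₂ - 8)*n^2 + (3*α₀^3 + α₁^3 +
    α₂^3 + 12*α₀^2*α₁ + 12*α₀^2*α₂ + 3*α₀*α₁^2 + 3*α₀*α₂^2 + 33*α₀*α₁*α₂ + 8*α₁^2*α₂ +
    8*α₁*α₂^2 - 3*α₀ - 4*α₁ - 4*α₂)*n + α₀^3*α₁ + α₀^3*α₂ + 6*α₀^2*α₁*α₂ + α₁^3*α₂ + α₁*α₂^3 +
    3*α₀*α₁^2*α₂ + 3*α₀*α₁*α₂^2 - α₀*α₁ - α₀*α₂ - 2*α₁*α₂)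

/-- Denominator of the formula for `c_{2n}`. -/
def cEvenDen (α₀ α₁ α₂ n : ℝ) : ℝ :=
  (3*n + α₀ + α₁ + 1) * (3*n + α₀ + α₂ + 1) * (3*n + α₀ + α₁)^2 * (3*n + α₀ + α₂)^2 * (3*n +
    α₀ + α₁ - 1) * (3*n + α₀ + α₂ - 1)

/-- Numerator of the formula for `c_{2n+1}`. -/
def cOddNum (α₀ α₁ α₂ n : ℝ) : ℝ :=
  (2*n + α₀ + 1) * (2*n + α₀ + α₁ + 1) * (2*n + α₀ + α₂ + 1) * (54*n^5 + (63*α₀ + 45*α₁ +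
    45*α₂ + 135)*n^4 + (24*α₀^2 + 8*α₁^2 + 8*α₂^2 + 42*α₀*α₁ + 42*α₀*α₂ + 44*α₁*α₂ + 126*α₀ +
    76*α₁ + 104*α₂ + 120)*n^3 + (3*α₀^3 + α₁^3 + α₂^3 + 12*α₀^2*α₁ + 12*α₀^2*α₂ + 3*α₀*α₁^2 +
    3*α₀*α₂^2 + 33*α₀*α₁*α₂ + 8*α₁^2*α₂ + 8*α₁*α₂^2 + 36*α₀^2 + 5*α₁^2 + 19*α₂^2 + 54*α₀*α₁ +
    72*α₀*α₂ + 66*α₁*α₂ + 87*α₀ + 39*α₁ + 81*α₂ + 45)*n^2 + (α₀^3*α₁ + α₀^3*α₂ + 6*α₀^2*α₁*α₂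
    + α₁^3*α₂ + α₁*α₂^3 + 3*α₀*α₁^2*α₂ + 3*α₀*α₁*α₂^2 + 3*α₀^3 + 2*α₂^3 + 12*α₀^2*α₁ +
    12*α₀^2*α₂ + 6*α₀*α₂^2 + 33*α₀*α₁*α₂ + 5*α₁^2*α₂ + 11*α₁*α₂^2 + 18*α₀^2 + 20*α₀*α₁ +
    38*α₀*α₂ + 14*α₂^2 + 26*α₁*α₂ + 24*α₀ + 6*α₁ + 24*α₂ + 6)*n + α₀^3*α₁ + 3*α₀^2*α₁*α₂ +
    3*α₀*α₁*α₂^2 + α₁*α₂^3 + α₀^3 + α₂^3 + 3*α₀^2*α₁ + 3*α₀^2*α₂ + 6*α₀*α₁*α₂ + 3*α₀*α₂^2 +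
    3*α₁*α₂^2 + 3*α₀^2 + 3*α₂^2 + 2*α₀*α₁ + 6*α₀*α₂ + 2*α₁*α₂ + 2*α₀ + 2*α₂)

/-- Denominator of the formula for `c_{2n+1}`. -/
def cOddDen (α₀ α₁ α₂ n : ℝ) : ℝ :=
  (3*n + α₀ + α₁ + 3) * (3*n + α₀ + α₂ + 2) * (3*n + α₀ + α₁ + 2)^2 * (3*n + α₀ + α₂ + 1)^2 *
    (3*n + α₀ + α₁ + 1) * (3*n + α₀ + α₂)

/-- Numerator of the formula for `d_{2n}`. -/
def dEvenNum (α₀ α₁ α₂ n : ℝ) : ℝ :=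
  n * (2*n + α₀) * (2*n + α₀ - 1) * (2*n + α₀ + α₁) * (2*n + α₀ + α₁ - 1) * (2*n + α₀ + α₂) *
    (2*n + α₀ + α₂ - 1) * (n + α₁) * (n + α₁ - α₂)

/-- Denominator of the formula for `d_{2n}`. -/
def dEvenDen (α₀ α₁ α₂ n : ℝ) : ℝ :=
  (3*n + 1 + α₀ + α₁) * (3*n + α₀ + α₁)^2 * (3*n + α₀ + α₂) * (3*n - 1 + α₀ + α₁)^2 * (3*n - 1
    + α₀ + α₂) * (3*n - 2 + α₀ + α₁) * (3*n - 2 + α₀ + α₂)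

/-- Numerator of the formula for `d_{2n+1}`. -/
def dOddNum (α₀ α₁ α₂ n : ℝ) : ℝ :=
  n * (2*n + 1 + α₀) * (2*n + α₀) * (2*n + α₀ + α₁) * (2*n + 1 + α₀ + α₁) * (2*n + 1 + α₀ +
    α₂) * (2*n + α₀ + α₂) * (n + α₂) * (n + α₂ - α₁)

/-- Denominator of the formula for `d_{2n+1}`. -/
def dOddDen (α₀ α₁ α₂ n : ℝ) : ℝ :=
  (3*n + 2 + α₀ + α₁) * (3*n + 2 + α₀ + α₂) * (3*n + 1 + α₀ + α₁) * (3*n + 1 + α₀ + α₂)^2 *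
    (3*n + α₀ + α₁) * (3*n + α₀ + α₂)^2 * (3*n - 1 + α₀ + α₂)

end JacobiPineiro

namespace JacobiPineiro

open MeasureTheory

/-! Everything is read off from the Mellin-type transform `s ↦ ∫ p(x) x^s (1-x)^a dx`. For `p` of
degree `N` it equals `B(s+1, a+1)` times a polynomial in `s` of degree at most `N`, divided by
`∏_{i<N} (s+a+2+i)` (`weightedIntegral_mul_prod`). That polynomial vanishes only when `p` does
(`transformNum_ne_zero`), so a `p` of degree less than `N` whose transform has `N` zeros greater
than `-1` is zero. Orthogonality of `P_N` says that its transform vanishes at the first `N` of the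
points `a₁, a₂, a₁+1, a₂+1, …`, which are distinct because `a₁ - a₂` is not an integer. This gives
uniqueness, and forces the transform of `P_N` to be an explicit product, up to a constant.

Existence comes by running the recurrence backwards. Multiplication by `x` is the shift `s ↦ s+1`,
and for the explicit products this shift telescopes (`transform_add_one`). After division by the
transform of index `n`, the four-term recurrence becomes an identity between cubics in `s`, whose
coefficients are found by evaluation at four points (`shiftCubic_eq`). The polynomials are then
defined by the recurrence with these coefficients; induction shows that their transforms are the
explicit products (`weightedIntegral_nearlyDiagonal`), hence that they are orthogonal. The closed
formulas are algebraic simplification, and the limits are ratios of leading coefficients in `n`. -/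

/-- The integral of `p(x) x^s (1-x)^a` over `[0, 1]`. -/
noncomputable def weightedIntegral (a : ℝ) (p : ℝ[X]) (s : ℝ) : ℝ :=
  ∫ x in (0 : ℝ)..1, p.eval x * (x ^ s * (1 - x) ^ a)

/-! ### Weighted integrals and the beta function -/

lemma intervalIntegrable_weight {a s : ℝ} (ha : -1 < a) (hs : -1 < s) :
    IntervalIntegrable (fun x : ℝ => x ^ s * (1 - x) ^ a) volume 0 1 := by
  have h := Complex.betaIntegral_convergent (u := ((s + 1 : ℝ) : ℂ)) (v := ((a + 1 : ℝ) : ℂ))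
    (by simp only [Complex.ofReal_re]; linarith) (by simp only [Complex.ofReal_re]; linarith)
  have h2 : IntervalIntegrable (fun x : ℝ => ((x ^ s * (1 - x) ^ a : ℝ) : ℂ)) volume 0 1 := by
    refine h.congr_uIoo ?_
    intro x hx
    rw [Set.uIoo_of_le zero_le_one] at hx
    simp only [Complex.ofReal_mul]
    rw [Complex.ofReal_cpow hx.1.le, Complex.ofReal_cpow (by linarith [hx.2])]
    push_cast
    congr 2 <;> ring
  rw [intervalIntegrable_iff] at h2 ⊢
  simpa [IntegrableOn] using h2.re

lemma integral_weight {a s : ℝ} (ha : -1 < a) (hs : -1 < s) :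
    ∫ x in (0 : ℝ)..1, x ^ s * (1 - x) ^ a = ProbabilityTheory.beta (s + 1) (a + 1) := by
  rw [ProbabilityTheory.beta_eq_betaIntegralReal _ _ (by linarith) (by linarith),
    Complex.betaIntegral]
  have : ∫ x in (0 : ℝ)..1, (x : ℂ) ^ (((s + 1 : ℝ) : ℂ) - 1) * (1 - (x : ℂ)) ^
      (((a + 1 : ℝ) : ℂ) - 1) = ∫ x in (0 : ℝ)..1, ((x ^ s * (1 - x) ^ a : ℝ) : ℂ) := by
    refine intervalIntegral.integral_congr_uIoo ?_
    intro x hx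
    rw [Set.uIoo_of_le zero_le_one] at hx
    simp only [Complex.ofReal_mul]
    rw [Complex.ofReal_cpow hx.1.le, Complex.ofReal_cpow (by linarith [hx.2])]
    push_cast
    congr 2 <;> ring
  rw [this, intervalIntegral.integral_ofReal, Complex.ofReal_re]

lemma intervalIntegrable_eval_mul_weight {a s : ℝ} (ha : -1 < a) (hs : -1 < s) (p : ℝ[X]) :
    IntervalIntegrable (fun x : ℝ => p.eval x * (x ^ s * (1 - x) ^ a)) volume 0 1 :=
  (intervalIntegrable_weight ha hs).continuousOn_mul p.continuous.continuousOn

lemma weightedIntegral_add {a s : ℝ} (ha : -1 < a) (hs : -1 < s) (p q : ℝ[X]) :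
    weightedIntegral a (p + q) s = weightedIntegral a p s + weightedIntegral a q s := by
  simp only [weightedIntegral, eval_add, add_mul]
  exact intervalIntegral.integral_add (intervalIntegrable_eval_mul_weight ha hs p)
    (intervalIntegrable_eval_mul_weight ha hs q)

lemma weightedIntegral_C_mul (a s c : ℝ) (p : ℝ[X]) :
    weightedIntegral a (C c * p) s = c * weightedIntegral a p s := by
  simp only [weightedIntegral, eval_mul, eval_C, mul_assoc]
  exact intervalIntegral.integral_const_mul _ _

lemma weightedIntegral_sub {a s : ℝ} (ha : -1 < a) (hs : -1 < s) (p q : ℝ[X]) :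
    weightedIntegral a (p - q) s = weightedIntegral a p s - weightedIntegral a q s := by
  have h := weightedIntegral_add ha hs (p - q) q
  rw [sub_add_cancel] at h
  linarith

lemma weightedIntegral_X_pow_mul (a s : ℝ) (p : ℝ[X]) (k : ℕ) :
    weightedIntegral a (X ^ k * p) s = weightedIntegral a p (s + k) := by
  -- The open interval matters: splitting `x ^ (s + k)` can fail at `x = 0`.
  refine intervalIntegral.integral_congr_uIoo ?_
  intro x hx
  rw [Set.uIoo_of_le zero_le_one] at hx
  simp only [eval_mul, eval_pow, eval_X]
  rw [Real.rpow_add_natCast hx.1.ne']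
  ring

lemma weightedIntegral_X_mul (a s : ℝ) (p : ℝ[X]) :
    weightedIntegral a (X * p) s = weightedIntegral a p (s + 1) := by
  simpa using weightedIntegral_X_pow_mul a s p 1

lemma weightedIntegral_one {a s : ℝ} (ha : -1 < a) (hs : -1 < s) :
    weightedIntegral a 1 s = ProbabilityTheory.beta (s + 1) (a + 1) := by
  simp only [weightedIntegral, eval_one, one_mul]
  exact integral_weight ha hs

lemma integral_mul_pow_eq_weightedIntegral (a s : ℝ) (p : ℝ[X]) (k : ℕ) :
    ∫ x in (0 : ℝ)..1, p.eval x * x ^ s * (1 - x) ^ a * x ^ k = weightedIntegral a p (s + k) := by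
  refine intervalIntegral.integral_congr_uIoo ?_
  intro x hx
  rw [Set.uIoo_of_le zero_le_one] at hx
  simp only
  rw [Real.rpow_add_natCast hx.1.ne']
  ring

lemma beta_add_one_left {u v : ℝ} (hu : 0 < u) (hv : 0 < v) :
    ProbabilityTheory.beta (u + 1) v * (u + v) = u * ProbabilityTheory.beta u v := by
  have h1 := Real.Gamma_add_one hu.ne'
  have h2 := Real.Gamma_add_one (add_pos hu hv).ne'
  have h3 := (Real.Gamma_pos_of_pos (add_pos hu hv)).ne'
  have h4 := (add_pos hu hv).ne'
  rw [ProbabilityTheory.beta, ProbabilityTheory.beta, add_right_comm, h1, h2]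
  field_simp

lemma beta_add_nat_left {u v : ℝ} (hu : 0 < u) (hv : 0 < v) (j : ℕ) :
    ProbabilityTheory.beta (u + j) v * ∏ i ∈ Finset.range j, (u + v + i) =
      ProbabilityTheory.beta u v * ∏ i ∈ Finset.range j, (u + i) := by
  induction j with
  | zero => simp
  | succ j ih =>
    have h := beta_add_one_left (u := u + j) (v := v) (by positivity) hv
    rw [Finset.prod_range_succ, Finset.prod_range_succ, ← mul_assoc, ← mul_assoc, ← ih]
    push_cast
    rw [← add_assoc]
    linear_combination (∏ i ∈ Finset.range j, (u + v + i)) * h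

/-! ### Transforms of polynomials and counting their zeros -/

/-- The numerator of the Mellin-type transform `s ↦ weightedIntegral a p s`, for `p` of degree at
most `N`. -/
noncomputable def transformNum (a : ℝ) (N : ℕ) (p : ℝ[X]) : ℝ[X] :=
  ∑ j ∈ Finset.range (N + 1), C (p.coeff j) *
    ((∏ i ∈ Finset.range j, (X + C (1 + i : ℝ))) * ∏ i ∈ Finset.Ico j N, (X + C (a + 2 + i : ℝ)))

lemma natDegree_transformNum_le (a : ℝ) (N : ℕ) (p : ℝ[X]) :
    (transformNum a N p).natDegree ≤ N := by
  refine natDegree_sum_le_of_forall_le _ _ fun j hj => ?_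
  have hj : j ≤ N := Nat.lt_succ_iff.mp (Finset.mem_range.mp hj)
  refine (natDegree_C_mul_le _ _).trans (natDegree_mul_le.trans ?_)
  have h (s : Finset ℕ) (f : ℕ → ℝ) : (∏ i ∈ s, (X + C (f i))).natDegree ≤ s.card := by
    refine (natDegree_prod_le _ _).trans ?_
    simp
  refine (add_le_add (h _ _) (h _ _)).trans ?_
  simp only [Finset.card_range, Nat.card_Ico]
  omega

/-- At `s = -(a + 1 + N)`, with `N` the degree of `p`, every summand with `j < N` contains the
vanishing factor `i = N - 1`. What is left is the leading coefficient times factors `i - a - N`, all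
negative since `a > -1`. -/
lemma transformNum_ne_zero {a : ℝ} (ha : -1 < a) {p : ℝ[X]} (hp : p ≠ 0) :
    transformNum a p.natDegree p ≠ 0 := by
  intro h
  have h1 := congrArg (eval (-(a + 1 + p.natDegree))) h
  rw [transformNum, Finset.sum_range_succ, eval_add, eval_zero, eval_finsetSum,
    Finset.sum_eq_zero, zero_add] at h1
  · simp only [Finset.Ico_self, Finset.prod_empty, mul_one, eval_mul, eval_C, eval_prod, eval_add,
      eval_X, mul_eq_zero, Finset.prod_eq_zero_iff, Finset.mem_range] at h1
    rcases h1 with h1 | ⟨i, hi, h1⟩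
    · exact hp (leadingCoeff_eq_zero.mp h1)
    · have : (i : ℝ) + 1 ≤ p.natDegree := by exact_mod_cast hi
      linarith
  · intro j hj
    have hj := Finset.mem_range.mp hj
    simp only [eval_mul, eval_prod, eval_C]
    rw [Finset.prod_eq_zero (i := p.natDegree - 1) (s := Finset.Ico j p.natDegree)
      (Finset.mem_Ico.mpr ⟨by omega, by omega⟩)]
    · ring
    · have : ((p.natDegree - 1 : ℕ) : ℝ) = p.natDegree - 1 := by
        rw [Nat.cast_sub (by omega)]; simp
      simp only [eval_add, eval_X, eval_C, this]
      ring

lemma weightedIntegral_sum {a s : ℝ} (ha : -1 < a) (hs : -1 < s) (t : Finset ℕ)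
    (f : ℕ → ℝ[X]) :
    weightedIntegral a (∑ j ∈ t, f j) s = ∑ j ∈ t, weightedIntegral a (f j) s := by
  induction t using Finset.cons_induction with
  | empty => simp [weightedIntegral]
  | cons j t hj ih => rw [Finset.sum_cons, Finset.sum_cons, weightedIntegral_add ha hs, ih]

/-- The monomial `x ^ j` turns `B(s+1, a+1)` into `B(s+1+j, a+1)`, which multiplies it by `∏_{i<j}
(s+1+i)/(s+a+2+i)`; the product on the left is a common denominator for all `j` up to the degree. -/
lemma weightedIntegral_mul_prod {a s : ℝ} (ha : -1 < a) (hs : -1 < s) (p : ℝ[X]) :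
    weightedIntegral a p s * ∏ i ∈ Finset.range p.natDegree, (s + a + 2 + i) =
      ProbabilityTheory.beta (s + 1) (a + 1) * (transformNum a p.natDegree p).eval s := by
  have hp : weightedIntegral a p s = weightedIntegral a
      (∑ j ∈ Finset.range (p.natDegree + 1), C (p.coeff j) * X ^ j) s := by
    rw [← p.as_sum_range_C_mul_X_pow]
  rw [hp, weightedIntegral_sum ha hs, transformNum, eval_finsetSum, Finset.sum_mul, Finset.mul_sum]
  refine Finset.sum_congr rfl fun j hj => ?_
  have hj : j ≤ p.natDegree := Nat.lt_succ_iff.mp (Finset.mem_range.mp hj)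
  have h1 := beta_add_nat_left (u := s + 1) (v := a + 1) (by linarith) (by linarith) j
  have h2 := weightedIntegral_X_pow_mul a s 1 j
  have hj0 : (0 : ℝ) ≤ j := j.cast_nonneg
  rw [mul_one, weightedIntegral_one ha (by linarith)] at h2
  rw [weightedIntegral_C_mul, h2, ← Finset.prod_range_mul_prod_Ico _ hj]
  simp only [eval_mul, eval_C, eval_prod, eval_add, eval_X]
  have e1 : ∏ i ∈ Finset.range j, (s + a + 2 + (i : ℝ)) =
      ∏ i ∈ Finset.range j, (s + 1 + (a + 1) + (i : ℝ)) :=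
    Finset.prod_congr rfl fun i _ => by ring
  have e2 : ∏ i ∈ Finset.range j, (s + (1 + (i : ℝ))) = ∏ i ∈ Finset.range j, (s + 1 + (i : ℝ)) :=
    Finset.prod_congr rfl fun i _ => by ring
  have e3 : ∏ i ∈ Finset.Ico j p.natDegree, (s + a + 2 + (i : ℝ)) =
      ∏ i ∈ Finset.Ico j p.natDegree, (s + (a + 2 + (i : ℝ))) :=
    Finset.prod_congr rfl fun i _ => by ring
  have e4 : s + (j : ℝ) + 1 = s + 1 + j := by ring
  rw [e1, e2, e3, e4]
  linear_combination
    p.coeff j * (∏ i ∈ Finset.Ico j p.natDegree, (s + (a + 2 + (i : ℝ)))) * h1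

/-- A polynomial whose transform vanishes at more points than its degree is zero. -/
lemma eq_zero_of_weightedIntegral_eq_zero {a : ℝ} (ha : -1 < a) {N : ℕ} {τ : ℕ → ℝ}
    (hτ : ∀ j, -1 < τ j) (hinj : Function.Injective τ) {p : ℝ[X]} (hdeg : p.degree < N)
    (h : ∀ j < N, weightedIntegral a p (τ j) = 0) : p = 0 := by
  by_contra hp
  have hN : p.natDegree < N := (natDegree_lt_iff_degree_lt hp).mpr hdeg
  refine transformNum_ne_zero ha hp
    (eq_zero_of_natDegree_lt_card_of_eval_eq_zero' _ ((Finset.range N).image τ) ?_ ?_)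
  · intro s hs
    obtain ⟨j, hj, rfl⟩ := Finset.mem_image.mp hs
    have h1 := weightedIntegral_mul_prod ha (hτ j) p
    rw [h j (Finset.mem_range.mp hj), zero_mul, eq_comm, mul_eq_zero] at h1
    exact h1.resolve_left
      (ProbabilityTheory.beta_pos (by linarith [hτ j]) (by linarith)).ne'
  · rw [Finset.card_image_of_injective _ hinj, Finset.card_range]
    exact (natDegree_transformNum_le _ _ _).trans_lt hN

/-! ### The explicit transforms and their shift -/

/-- The zeros `a₁, a₂, a₁ + 1, a₂ + 1, …` of the transforms of the nearly diagonal polynomials. -/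
def node (a₁ a₂ : ℝ) : ℕ → ℝ
  | 0 => a₁
  | 1 => a₂
  | n + 2 => node a₁ a₂ n + 1

lemma node_two_mul (a₁ a₂ : ℝ) (n : ℕ) : node a₁ a₂ (2 * n) = a₁ + n := by
  induction n with
  | zero => simp [node]
  | succ n ih => rw [mul_add, mul_one, node, ih]; push_cast; ring

lemma node_two_mul_add_one (a₁ a₂ : ℝ) (n : ℕ) : node a₁ a₂ (2 * n + 1) = a₂ + n := by
  induction n with
  | zero => simp [node]
  | succ n ih =>
    rw [show 2 * (n + 1) + 1 = 2 * n + 1 + 2 by ring, node, ih]; push_cast; ring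

lemma node_gt {a₁ a₂ : ℝ} (h₁ : -1 < a₁) (h₂ : -1 < a₂) (n : ℕ) : -1 < node a₁ a₂ n := by
  obtain ⟨k, rfl | rfl⟩ := n.even_or_odd'
  · rw [node_two_mul]; linarith [(k.cast_nonneg : (0 : ℝ) ≤ k)]
  · rw [node_two_mul_add_one]; linarith [(k.cast_nonneg : (0 : ℝ) ≤ k)]

lemma node_injective {a₁ a₂ : ℝ} (h : ∀ z : ℤ, a₁ - a₂ ≠ z) :
    Function.Injective (node a₁ a₂) := by
  intro m n hmn
  obtain ⟨j, rfl | rfl⟩ := m.even_or_odd' <;> obtain ⟨k, rfl | rfl⟩ := n.even_or_odd' <;>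
    simp only [node_two_mul, node_two_mul_add_one, add_right_inj, Nat.cast_inj] at hmn
  · rw [hmn]
  · exact (h (k - j) (by push_cast; linarith)).elim
  · exact (h (j - k) (by push_cast; linarith)).elim
  · rw [hmn]

/-- The ratio of the leading factors of consecutive transforms. -/
noncomputable def leadRatio (a a₁ a₂ : ℝ) : ℕ → ℝ
  | 0 => (a + 1) / (a + a₁ + 2)
  | n + 1 => (a + n + 2) * (a + n + 2 + a₁) * (a + n + 2 + a₂) /
      ((node a₁ a₂ (n + 1) + (a + n + 2)) * (node a₁ a₂ (n + 2) + (a + n + 2)) *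
        (node a₁ a₂ (n + 1) + (a + n + 3)))

/-- The transform `s ↦ ∫ P_n(x) x^s (1-x)^a dx` of the nearly diagonal polynomial `P_n`. -/
noncomputable def transform (a a₁ a₂ : ℝ) : ℕ → ℝ → ℝ
  | 0, s => ProbabilityTheory.beta (s + 1) (a + 1)
  | n + 1, s => transform a a₁ a₂ n s *
      (leadRatio a a₁ a₂ n * (s - node a₁ a₂ n) / (s + a + n + 2))

lemma transform_node_eq_zero (a a₁ a₂ : ℝ) {j n : ℕ} (h : j < n) :
    transform a a₁ a₂ n (node a₁ a₂ j) = 0 := by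
  induction n, h using Nat.le_induction with
  | base => simp [transform]
  | succ n _ ih => rw [transform, ih, zero_mul]

/-- The cubic polynomial produced by shifting the argument of the transform. -/
def shiftCubic (a₁ a₂ s : ℝ) : ℝ := (s + 1) * (s + 1 - a₁) * (s + 1 - a₂)

/-- Since the nodes satisfy `node (n + 2) = node n + 1`, the shift `s ↦ s + 1` sends each zero
factor to the one two places earlier, so the products telescope. The two initial zero factors and
the factor `s + 1` from the beta function remain, and form `shiftCubic`. -/
lemma transform_add_one {a s : ℝ} (a₁ a₂ : ℝ) (ha : -1 < a) (hs : -1 < s) (n : ℕ) :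
    transform a a₁ a₂ (n + 2) (s + 1) = transform a a₁ a₂ n s *
      (leadRatio a a₁ a₂ n * leadRatio a a₁ a₂ (n + 1) * shiftCubic a₁ a₂ s /
        ((s + a + n + 2) * (s + a + n + 3) * (s + a + n + 4))) := by
  induction n with
  | zero =>
    have h := beta_add_one_left (u := s + 1) (v := a + 1) (by linarith) (by linarith)
    have h2 : s + a + 2 ≠ 0 := by linarith
    have h3 : s + a + 3 ≠ 0 := by linarith
    have h4 : s + a + 4 ≠ 0 := by linarith
    have h' : ProbabilityTheory.beta (s + 1 + 1) (a + 1) =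
        ProbabilityTheory.beta (s + 1) (a + 1) * (s + 1) / (s + a + 2) := by
      rw [eq_div_iff h2]; linear_combination h
    simp only [transform, node, Nat.cast_zero, zero_add, Nat.cast_one, h', shiftCubic]
    rw [show s + 1 + a + 0 + 2 = s + a + 3 by ring, show s + 1 + a + 1 + 2 = s + a + 4 by ring,
      show s + a + 0 + 2 = s + a + 2 by ring, show s + a + 0 + 3 = s + a + 3 by ring,
      show s + a + 0 + 4 = s + a + 4 by ring]
    field_simp
  | succ n ih =>
    have hn : (0 : ℝ) ≤ n := n.cast_nonneg
    have h2 : s + a + n + 2 ≠ 0 := by linarith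
    have h3 : s + a + n + 3 ≠ 0 := by linarith
    have h4 : s + a + n + 4 ≠ 0 := by linarith
    have h5 : s + a + n + 5 ≠ 0 := by linarith
    rw [transform, ih, transform, node]
    push_cast
    rw [show s + 1 + a + (n + 2) + 2 = s + a + n + 5 by ring,
      show s + 1 - (node a₁ a₂ n + 1) = s - node a₁ a₂ n by ring,
      show s + a + (n + 1) + 2 = s + a + n + 3 by ring,
      show s + a + (n + 1) + 3 = s + a + n + 4 by ring,
      show s + a + (n + 1) + 4 = s + a + n + 5 by ring]
    field_simp

/-- This is the recurrence with the common transform divided out: `p`, `q`, `p + 1` are three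
successive nodes and `w = a + n + 2`. The evaluations are triangular: at `p` only the last term
survives, at `q` the last two, at `-w-2` only the first, at `-w-1` the first two. They determine the
four coefficients. -/
lemma shiftCubic_eq {a₁ a₂ p q w : ℝ} (hp : p + w > 0) (hq : q + w > 0) (hpq : q - p ≠ 0)
    (s : ℝ) :
    shiftCubic a₁ a₂ s =
      (w + 1) * (w + 1 + a₁) * (w + 1 + a₂) / ((p + w + 2) * (q + w + 2) * (p + w + 3)) *
        ((s - p) * (s - q) * (s - p - 1)) +
      ((w + 1) * (w + 1 + a₁) * (w + 1 + a₂) / ((q + w + 2) * (p + w + 3)) -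
        w * (w + a₁) * (w + a₂) / ((p + w + 1) * (q + w + 1))) *
        ((s - p) * (s - q) * (s + w + 2)) +
      (shiftCubic a₁ a₂ q / ((q + w + 1) * (q + w + 2)) -
        shiftCubic a₁ a₂ p * (q + w) / ((p + w) * (p + w + 1) * (p + w + 2))) / (q - p) *
        ((s - p) * (s + w + 1) * (s + w + 2)) +
      shiftCubic a₁ a₂ p / ((p + w) * (p + w + 1) * (p + w + 2)) *
        ((s + w) * (s + w + 1) * (s + w + 2)) := by
  have hp1 : p + w + 1 ≠ 0 := by positivity
  have hp2 : p + w + 2 ≠ 0 := by positivity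
  have hp3 : p + w + 3 ≠ 0 := by positivity
  have hq1 : q + w + 1 ≠ 0 := by positivity
  have hq2 : q + w + 2 ≠ 0 := by positivity
  set B := (w + 1) * (w + 1 + a₁) * (w + 1 + a₂) / ((q + w + 2) * (p + w + 3)) -
        w * (w + a₁) * (w + a₂) / ((p + w + 1) * (q + w + 1)) with hB
  set A := (w + 1) * (w + 1 + a₁) * (w + 1 + a₂) /
    ((p + w + 2) * (q + w + 2) * (p + w + 3)) with hA
  set D := shiftCubic a₁ a₂ p / ((p + w) * (p + w + 1) * (p + w + 2)) with hD
  set E := (shiftCubic a₁ a₂ q / ((q + w + 1) * (q + w + 2)) -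
        shiftCubic a₁ a₂ p * (q + w) / ((p + w) * (p + w + 1) * (p + w + 2))) / (q - p) with hE
  have eD : D * ((p + w) * (p + w + 1) * (p + w + 2)) = shiftCubic a₁ a₂ p := by
    rw [hD]; field_simp
  have eE : E * ((q - p) * (q + w + 1) * (q + w + 2)) +
      D * ((q + w) * (q + w + 1) * (q + w + 2)) = shiftCubic a₁ a₂ q := by
    rw [hE, hD]; field_simp; ring
  have eA : A * ((p + w + 2) * (q + w + 2) * (p + w + 3)) =
      (w + 1) * (w + 1 + a₁) * (w + 1 + a₂) := by
    rw [hA]; field_simp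
  have eB : B * ((p + w + 1) * (q + w + 1)) -
      A * ((p + w + 1) * (q + w + 1) * (p + w + 2)) = -(w * (w + a₁) * (w + a₂)) := by
    rw [hB, hA]; field_simp; ring
  clear_value A B D E
  let f : ℝ[X] := (X + 1) * (X + 1 - C a₁) * (X + 1 - C a₂) -
    (C A * ((X - C p) * (X - C q) * (X - C p - 1)) +
      C B * ((X - C p) * (X - C q) * (X + C w + 2)) +
      C E * ((X - C p) * (X + C w + 1) * (X + C w + 2)) +
      C D * ((X + C w) * (X + C w + 1) * (X + C w + 2)))
  have hdeg : f.natDegree ≤ 3 := by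
    simp only [f]; compute_degree
  have heval (t : ℝ) : f.eval t = shiftCubic a₁ a₂ t -
      (A * ((t - p) * (t - q) * (t - p - 1)) + B * ((t - p) * (t - q) * (t + w + 2)) +
      E * ((t - p) * (t + w + 1) * (t + w + 2)) +
      D * ((t + w) * (t + w + 1) * (t + w + 2))) := by
    simp [f, shiftCubic]
  have hcard : ({p, q, -w - 1, -w - 2} : Finset ℝ).card = 4 := by
    rw [Finset.card_insert_of_notMem, Finset.card_insert_of_notMem, Finset.card_insert_of_notMem,
      Finset.card_singleton]
    · simp
    · simp only [Finset.mem_insert, Finset.mem_singleton, not_or]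
      exact ⟨fun h => hq1 (by linarith), fun h => hq2 (by linarith)⟩
    · simp only [Finset.mem_insert, Finset.mem_singleton, not_or]
      exact ⟨fun h => hpq (by linarith), fun h => hp1 (by linarith), fun h => hp2 (by linarith)⟩
  have hf : f = 0 := by
    -- The difference of the two sides has degree at most three and vanishes at four distinct
    -- points.
    refine eq_zero_of_natDegree_lt_card_of_eval_eq_zero' f {p, q, -w - 1, -w - 2} ?_ (by omega)
    intro t ht
    simp only [Finset.mem_insert, Finset.mem_singleton] at ht
    rw [heval]
    rcases ht with rfl | rfl | rfl | rfl
    · linear_combination -eD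
    · linear_combination -eE
    · simp only [shiftCubic]; linear_combination -eB
    · simp only [shiftCubic]; linear_combination eA
  have := heval s
  rw [hf, eval_zero] at this
  linarith

/-! ### Recurrence coefficients and construction of the polynomials -/

/-- The coefficients `b_n` of the recurrence. -/
noncomputable def coeffB (a a₁ a₂ : ℝ) : ℕ → ℝ
  | 0 => (a₁ + 1) / (a + a₁ + 2)
  | 1 => ((a₁ + 1) * (a + a₂ + 2) + (a₂ + 2) * (a + a₁ + 3)) /
      ((a + a₁ + 3) * (a + a₂ + 3)) - (a₁ + 1) / (a + a₁ + 2)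
  | n + 2 =>
    let w := a + n + 2
    let p := node a₁ a₂ n
    let q := node a₁ a₂ (n + 1)
    (w + 1) * (w + 1 + a₁) * (w + 1 + a₂) / ((q + w + 2) * (p + w + 3)) -
      w * (w + a₁) * (w + a₂) / ((p + w + 1) * (q + w + 1))

/-- The coefficients `c_n` of the recurrence. -/
noncomputable def coeffC (a a₁ a₂ : ℝ) : ℕ → ℝ
  | 0 => 0
  | 1 => (a + 1) * (a₁ + 1) / ((a + a₁ + 2) ^ 2 * (a + a₁ + 3))
  | n + 2 =>
    let w := a + n + 2
    let p := node a₁ a₂ n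
    let q := node a₁ a₂ (n + 1)
    leadRatio a a₁ a₂ (n + 1) * ((shiftCubic a₁ a₂ q / ((q + w + 1) * (q + w + 2)) -
      shiftCubic a₁ a₂ p * (q + w) / ((p + w) * (p + w + 1) * (p + w + 2))) / (q - p))

/-- The coefficients `d_n` of the recurrence. -/
noncomputable def coeffD (a a₁ a₂ : ℝ) : ℕ → ℝ
  | 0 => 0
  | 1 => 0
  | n + 2 =>
    let w := a + n + 2
    let p := node a₁ a₂ n
    leadRatio a a₁ a₂ n * leadRatio a a₁ a₂ (n + 1) *
      (shiftCubic a₁ a₂ p / ((p + w) * (p + w + 1) * (p + w + 2)))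

/-- The nearly diagonal Jacobi–Piñeiro polynomials, generated by their recurrence. -/
noncomputable def nearlyDiagonal (a a₁ a₂ : ℝ) : ℕ → ℝ[X]
  | 0 => 1
  | 1 => X - C (coeffB a a₁ a₂ 0)
  | 2 => (X - C (coeffB a a₁ a₂ 1)) * (X - C (coeffB a a₁ a₂ 0)) - C (coeffC a a₁ a₂ 1)
  | n + 3 => X * nearlyDiagonal a a₁ a₂ (n + 2) -
      C (coeffB a a₁ a₂ (n + 2)) * nearlyDiagonal a a₁ a₂ (n + 2) -
      C (coeffC a a₁ a₂ (n + 2)) * nearlyDiagonal a a₁ a₂ (n + 1) -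
      C (coeffD a a₁ a₂ (n + 2)) * nearlyDiagonal a a₁ a₂ n

lemma fourTermRecurrence_nearlyDiagonal (a a₁ a₂ : ℝ) :
    FourTermRecurrence (nearlyDiagonal a a₁ a₂) (coeffB a a₁ a₂) (coeffC a a₁ a₂)
      (coeffD a a₁ a₂) := by
  refine ⟨rfl, rfl, rfl, ?_, ?_, fun n => ?_⟩
  · simp only [nearlyDiagonal]; ring
  · simp only [nearlyDiagonal]; ring
  · rw [nearlyDiagonal.eq_4]; ring

section Transform

variable {a a₁ a₂ s : ℝ}

lemma transform_one_recurrence (h₀ : -1 < a) (h₁ : -1 < a₁) (hs : -1 < s) :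
    transform a a₁ a₂ 0 (s + 1) =
      transform a a₁ a₂ 1 s + coeffB a a₁ a₂ 0 * transform a a₁ a₂ 0 s := by
  have h := beta_add_one_left (u := s + 1) (v := a + 1) (by linarith) (by linarith)
  have e1 : a + a₁ + 2 ≠ 0 := by linarith
  have e2 : s + a + 2 ≠ 0 := by linarith
  have h' : ProbabilityTheory.beta (s + 1 + 1) (a + 1) =
      ProbabilityTheory.beta (s + 1) (a + 1) * (s + 1) / (s + a + 2) := by
    rw [eq_div_iff e2]; linear_combination h
  simp only [transform, h', leadRatio, coeffB, node, Nat.cast_zero, add_zero]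
  field_simp
  ring

lemma transform_two_recurrence (h₀ : -1 < a) (h₁ : -1 < a₁) (h₂ : -1 < a₂) (hs : -1 < s) :
    transform a a₁ a₂ 1 (s + 1) = transform a a₁ a₂ 2 s +
      coeffB a a₁ a₂ 1 * transform a a₁ a₂ 1 s + coeffC a a₁ a₂ 1 * transform a a₁ a₂ 0 s := by
  have h := beta_add_one_left (u := s + 1) (v := a + 1) (by linarith) (by linarith)
  have e1 : a + a₁ + 2 ≠ 0 := by linarith
  have e2 : s + a + 2 ≠ 0 := by linarith
  have e3 : s + a + 3 ≠ 0 := by linarith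
  have e4 : a + a₁ + 3 ≠ 0 := by linarith
  have e5 : a + a₂ + 3 ≠ 0 := by linarith
  have e6 : a + a₂ + 2 ≠ 0 := by linarith
  have h' : ProbabilityTheory.beta (s + 1 + 1) (a + 1) =
      ProbabilityTheory.beta (s + 1) (a + 1) * (s + 1) / (s + a + 2) := by
    rw [eq_div_iff e2]; linear_combination h
  simp only [transform, h', leadRatio, coeffB, coeffC, node, Nat.cast_zero, add_zero,
    Nat.cast_one]
  rw [show s + 1 + a + 2 = s + a + 3 by ring, show a₂ + (a + 2) = a + a₂ + 2 by ring,
    show a₁ + 1 + (a + 2) = a + a₁ + 3 by ring, show a₂ + (a + 3) = a + a₂ + 3 by ring,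
    show s + a + 1 + 2 = s + a + 3 by ring]
  field_simp
  ring

lemma transform_recurrence (h₀ : -1 < a) (h₁ : -1 < a₁) (h₂ : -1 < a₂)
    (h₁₂ : ∀ z : ℤ, a₁ - a₂ ≠ z) (hs : -1 < s) (n : ℕ) :
    transform a a₁ a₂ (n + 2) (s + 1) = transform a a₁ a₂ (n + 3) s +
      coeffB a a₁ a₂ (n + 2) * transform a a₁ a₂ (n + 2) s +
      coeffC a a₁ a₂ (n + 2) * transform a a₁ a₂ (n + 1) s +
      coeffD a a₁ a₂ (n + 2) * transform a a₁ a₂ n s := by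
  have hn : (0 : ℝ) ≤ n := n.cast_nonneg
  have hp := node_gt h₁ h₂ n
  have hq := node_gt h₁ h₂ (n + 1)
  have hpq : node a₁ a₂ (n + 1) - node a₁ a₂ n ≠ 0 := fun h =>
    absurd (node_injective h₁₂ (sub_eq_zero.mp h)) (by omega)
  have key := shiftCubic_eq (a₁ := a₁) (a₂ := a₂) (p := node a₁ a₂ n) (q := node a₁ a₂ (n + 1))
    (w := a + n + 2) (by linarith) (by linarith) hpq s
  have e2 : s + a + n + 2 ≠ 0 := by linarith
  have e3 : s + a + n + 3 ≠ 0 := by linarith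
  have e4 : s + a + n + 4 ≠ 0 := by linarith
  -- Monicity requires the new transform to enter with coefficient 1; this holds because `leadRatio`
  -- is the first coefficient in `shiftCubic_eq`.
  have hr : leadRatio a a₁ a₂ (n + 2) = (a + n + 2 + 1) * (a + n + 2 + 1 + a₁) *
      (a + n + 2 + 1 + a₂) / ((node a₁ a₂ n + (a + n + 2) + 2) *
      (node a₁ a₂ (n + 1) + (a + n + 2) + 2) * (node a₁ a₂ n + (a + n + 2) + 3)) := by
    rw [leadRatio]
    simp only [node]
    push_cast
    congr 1 <;> ring
  rw [transform_add_one a₁ a₂ h₀ hs, key, ← hr, transform, transform, transform]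
  simp only [coeffB, coeffC, coeffD, node]
  push_cast
  rw [show s + a + (n + 1) + 2 = s + a + n + 3 by ring,
    show s + a + (n + 2) + 2 = s + a + n + 4 by ring]
  -- All coefficients become atoms, so that only the denominators in `s` have to be cleared.
  generalize transform a a₁ a₂ n s = G
  generalize leadRatio a a₁ a₂ n = r0
  generalize leadRatio a a₁ a₂ (n + 1) = r1
  generalize leadRatio a a₁ a₂ (n + 2) = r2
  generalize (_ : ℝ) / (node a₁ a₂ (n + 1) - node a₁ a₂ n) = x1
  generalize shiftCubic a₁ a₂ (node a₁ a₂ n) / (_ : ℝ) = x2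
  generalize (_ : ℝ) - (a + n + 2) * _ * _ / _ = x3
  field_simp
  ring

/-- Both sides obey the same recurrence in `n`. The induction hypothesis is needed at `s` and at `s
+ 1`, since a factor `X` shifts the exponent; hence `s` is quantified inside the induction. -/
lemma weightedIntegral_nearlyDiagonal (h₀ : -1 < a) (h₁ : -1 < a₁) (h₂ : -1 < a₂)
    (h₁₂ : ∀ z : ℤ, a₁ - a₂ ≠ z) (n : ℕ) :
    ∀ s : ℝ, -1 < s →
      weightedIntegral a (nearlyDiagonal a a₁ a₂ n) s = transform a a₁ a₂ n s := by
  obtain ⟨-, -, -, r0, r1, r2⟩ := fourTermRecurrence_nearlyDiagonal a a₁ a₂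
  induction n using Nat.strong_induction_on with
  | _ n ih =>
  intro s hs
  have hs' : -1 < s + 1 := by linarith
  match n, ih with
  | 0, _ => exact weightedIntegral_one h₀ hs
  | 1, ih =>
    have h := congrArg (fun p => weightedIntegral a p s) r0
    simp only [weightedIntegral_X_mul, weightedIntegral_add h₀ hs, weightedIntegral_C_mul,
      ih 0 (by omega) _ hs, ih 0 (by omega) _ hs'] at h
    linarith [transform_one_recurrence (a₂ := a₂) h₀ h₁ hs]
  | 2, ih =>
    have h := congrArg (fun p => weightedIntegral a p s) r1
    simp only [weightedIntegral_X_mul, weightedIntegral_add h₀ hs, weightedIntegral_C_mul,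
      ih 0 (by omega) _ hs, ih 1 (by omega) _ hs, ih 1 (by omega) _ hs'] at h
    linarith [transform_two_recurrence h₀ h₁ h₂ hs]
  | n + 3, ih =>
    have h := congrArg (fun p => weightedIntegral a p s) (r2 n)
    simp only [weightedIntegral_X_mul, weightedIntegral_add h₀ hs, weightedIntegral_C_mul,
      ih n (by omega) _ hs, ih (n + 1) (by omega) _ hs, ih (n + 2) (by omega) _ hs,
      ih (n + 2) (by omega) _ hs'] at h
    linarith [transform_recurrence h₀ h₁ h₂ h₁₂ hs n]

end Transform

lemma nearlyDiagonal_monic_natDegree (a a₁ a₂ : ℝ) (n : ℕ) :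
    (nearlyDiagonal a a₁ a₂ n).Monic ∧ (nearlyDiagonal a a₁ a₂ n).natDegree = n := by
  induction n using Nat.strong_induction_on with
  | _ n ih =>
  have key (n : ℕ) (p r : ℝ[X]) (hp : p.Monic ∧ p.natDegree = n) (hr : r.natDegree ≤ n) :
      (X * p + r).Monic ∧ (X * p + r).natDegree = n + 1 := by
    have h1 : (X * p).Monic := monic_X.mul hp.1
    have h2 : (X * p).natDegree = n + 1 := by
      rw [monic_X.natDegree_mul hp.1, natDegree_X, hp.2, add_comm]
    have h3 : r.degree < (X * p).degree := by
      rw [degree_eq_natDegree h1.ne_zero, h2]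
      exact (natDegree_le_iff_degree_le.mp hr).trans_lt (by exact_mod_cast n.lt_succ_self)
    exact ⟨h1.add_of_left h3, by rw [natDegree_add_eq_left_of_degree_lt h3, h2]⟩
  match n, ih with
  | 0, _ => exact ⟨monic_one, natDegree_one⟩
  | 1, _ => exact ⟨monic_X_sub_C _, natDegree_X_sub_C _⟩
  | 2, ih =>
    have h1 := ih 1 (by omega)
    convert! key 1 _ (C (-coeffB a a₁ a₂ 1) * nearlyDiagonal a a₁ a₂ 1 + C (-coeffC a a₁ a₂ 1))
      h1 ?_ using 2
    · simp only [nearlyDiagonal, C_neg]; ring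
    · simp only [nearlyDiagonal, C_neg]; ring_nf
    · refine natDegree_add_le_of_degree_le ((natDegree_C_mul_le _ _).trans h1.2.le) ?_
      simp
  | n + 3, ih =>
    convert! key (n + 2) _ (C (-coeffB a a₁ a₂ (n + 2)) * nearlyDiagonal a a₁ a₂ (n + 2) +
      C (-coeffC a a₁ a₂ (n + 2)) * nearlyDiagonal a a₁ a₂ (n + 1) +
      C (-coeffD a a₁ a₂ (n + 2)) * nearlyDiagonal a a₁ a₂ n) (ih (n + 2) (by omega)) ?_ using 2
    · rw [nearlyDiagonal.eq_4]; simp only [C_neg]; ring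
    · rw [nearlyDiagonal.eq_4]; simp only [C_neg]; ring_nf
    · refine natDegree_add_le_of_degree_le (natDegree_add_le_of_degree_le ?_ ?_) ?_
      · exact (natDegree_C_mul_le _ _).trans (ih (n + 2) (by omega)).2.le
      · exact (natDegree_C_mul_le _ _).trans (by rw [(ih (n + 1) (by omega)).2]; omega)
      · exact (natDegree_C_mul_le _ _).trans (by rw [(ih n (by omega)).2]; omega)

/-! ### Orthogonality, uniqueness of the polynomials and of the coefficients -/

section Characterization

variable {a a₁ a₂ : ℝ}

/-- Near the diagonal, the exponents `a₁ + j` (`j < m`) and `a₂ + j` (`j < k`) are exactly the first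
`N` nodes; `hm` and `hk` encode this interlacing. -/
lemma isJacobiPineiro_iff {m k N : ℕ} (hsum : m + k = N) (hm : ∀ j, 2 * j < N ↔ j < m)
    (hk : ∀ j, 2 * j + 1 < N ↔ j < k) (p : ℝ[X]) :
    IsJacobiPineiro a ![a₁, a₂] ![m, k] p ↔
      p.Monic ∧ p.natDegree = N ∧ ∀ j < N, weightedIntegral a p (node a₁ a₂ j) = 0 := by
  simp only [IsJacobiPineiro, Fin.sum_univ_two, Fin.forall_fin_two, Matrix.cons_val_zero,
    Matrix.cons_val_one, integral_mul_pow_eq_weightedIntegral, hsum]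
  refine and_congr_right fun _ => and_congr_right fun _ => ⟨fun h j hj => ?_, fun h => ?_⟩
  · obtain ⟨i, rfl | rfl⟩ := j.even_or_odd'
    · rw [node_two_mul]; exact h.1 i ((hm i).mp hj)
    · rw [node_two_mul_add_one]; exact h.2 i ((hk i).mp hj)
  · refine ⟨fun i hi => ?_, fun i hi => ?_⟩
    · rw [← node_two_mul a₁ a₂]; exact h _ ((hm i).mpr hi)
    · rw [← node_two_mul_add_one a₁ a₂]; exact h _ ((hk i).mpr hi)

lemma isNearlyDiagonal_iff (P : ℕ → ℝ[X]) :
    IsNearlyDiagonal a a₁ a₂ P ↔ ∀ N, (P N).Monic ∧ (P N).natDegree = N ∧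
      ∀ j < N, weightedIntegral a (P N) (node a₁ a₂ j) = 0 := by
  have h (n : ℕ) := isJacobiPineiro_iff (a := a) (a₁ := a₁) (a₂ := a₂) (m := n) (k := n)
    (N := 2 * n) (by ring) (by omega) (by omega)
  have h' (n : ℕ) := isJacobiPineiro_iff (a := a) (a₁ := a₁) (a₂ := a₂) (m := n + 1) (k := n)
    (N := 2 * n + 1) (by ring) (by omega) (by omega)
  simp only [IsNearlyDiagonal, h, h']
  refine ⟨fun H N => ?_, fun H n => ⟨H _, H _⟩⟩
  obtain ⟨n, rfl | rfl⟩ := N.even_or_odd'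
  exacts [(H n).1, (H n).2]

lemma isNearlyDiagonal_nearlyDiagonal (h₀ : -1 < a) (h₁ : -1 < a₁) (h₂ : -1 < a₂)
    (h₁₂ : ∀ z : ℤ, a₁ - a₂ ≠ z) : IsNearlyDiagonal a a₁ a₂ (nearlyDiagonal a a₁ a₂) := by
  rw [isNearlyDiagonal_iff]
  refine fun N => ⟨(nearlyDiagonal_monic_natDegree a a₁ a₂ N).1,
    (nearlyDiagonal_monic_natDegree a a₁ a₂ N).2, fun j hj => ?_⟩
  rw [weightedIntegral_nearlyDiagonal h₀ h₁ h₂ h₁₂ _ _ (node_gt h₁ h₂ j)]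
  exact transform_node_eq_zero a a₁ a₂ hj

/-- The difference of two monic candidates of degree `N` has smaller degree, while its transform
vanishes at `N` distinct nodes. -/
lemma IsNearlyDiagonal.unique (h₀ : -1 < a) (h₁ : -1 < a₁) (h₂ : -1 < a₂)
    (h₁₂ : ∀ z : ℤ, a₁ - a₂ ≠ z) {P Q : ℕ → ℝ[X]} (hP : IsNearlyDiagonal a a₁ a₂ P)
    (hQ : IsNearlyDiagonal a a₁ a₂ Q) : P = Q := by
  rw [isNearlyDiagonal_iff] at hP hQ
  funext N
  obtain ⟨pm, pd, pz⟩ := hP N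
  obtain ⟨qm, qd, qz⟩ := hQ N
  rw [← sub_eq_zero]
  refine eq_zero_of_weightedIntegral_eq_zero h₀ (node_gt h₁ h₂) (node_injective h₁₂) (N := N) ?_ ?_
  · have e : (P N).degree = (Q N).degree := by
      rw [degree_eq_natDegree pm.ne_zero, degree_eq_natDegree qm.ne_zero, pd, qd]
    have := degree_sub_lt_left e pm.ne_zero (by rw [pm.leadingCoeff, qm.leadingCoeff])
    rwa [degree_eq_natDegree pm.ne_zero, pd] at this
  · intro j hj
    rw [weightedIntegral_sub h₀ (node_gt h₁ h₂ j), pz j hj, qz j hj, sub_zero]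

/-- Degrees `n + 2`, `n + 1`, `n` make the comparison of coefficients triangular. -/
lemma eq_of_linear_combination {p q r : ℝ[X]} {n : ℕ} (hp : p.Monic) (hq : q.Monic)
    (hr : r.Monic) (hpn : p.natDegree = n + 2) (hqn : q.natDegree = n + 1)
    (hrn : r.natDegree = n) {b b' c c' d d' : ℝ}
    (h : C b * p + C c * q + C d * r = C b' * p + C c' * q + C d' * r) :
    b = b' ∧ c = c' ∧ d = d' := by
  have h1 := congrArg (fun f => f.coeff (n + 2)) h
  have h2 := congrArg (fun f => f.coeff (n + 1)) h
  have h3 := congrArg (fun f => f.coeff n) h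
  have p2 : p.coeff (n + 2) = 1 := hpn ▸ hp.coeff_natDegree
  have q1 : q.coeff (n + 1) = 1 := hqn ▸ hq.coeff_natDegree
  have r0 : r.coeff n = 1 := hrn ▸ hr.coeff_natDegree
  have q2 : q.coeff (n + 2) = 0 := coeff_eq_zero_of_natDegree_lt (by omega)
  have r2 : r.coeff (n + 2) = 0 := coeff_eq_zero_of_natDegree_lt (by omega)
  have r1 : r.coeff (n + 1) = 0 := coeff_eq_zero_of_natDegree_lt (by omega)
  simp only [coeff_add, coeff_C_mul, p2, q2, q1, r2, r1, r0, mul_zero, mul_one, add_zero] at h1 h2 h3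
  subst h1
  have h2 : c = c' := by linarith
  subst h2
  exact ⟨rfl, rfl, by linarith⟩

lemma FourTermRecurrence.unique {P : ℕ → ℝ[X]} (hP : ∀ n, (P n).Monic ∧ (P n).natDegree = n)
    {b c d b' c' d' : ℕ → ℝ} (h : FourTermRecurrence P b c d)
    (h' : FourTermRecurrence P b' c' d') : b' = b ∧ c' = c ∧ d' = d := by
  obtain ⟨c0, d0, d1, r0, r1, r2⟩ := h
  obtain ⟨c0', d0', d1', r0', r1', r2'⟩ := h'
  have e0 : P 0 = 1 := (hP 0).1.natDegree_eq_zero.mp (hP 0).2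
  have hb0 : b' 0 = b 0 := by
    rw [r0] at r0'
    have := add_left_cancel r0'
    rw [e0, mul_one, mul_one] at this
    exact (C_injective this).symm
  have h1 : b' 1 = b 1 ∧ c' 1 = c 1 := by
    have h1 := r1.symm.trans r1'
    have h2 := congrArg (fun f => f.coeff 1) h1
    have h3 := congrArg (fun f => f.coeff 0) h1
    have p1 : (P 1).coeff 1 = 1 := by
      have := (hP 1).1.coeff_natDegree
      rwa [(hP 1).2] at this
    simp only [coeff_add, coeff_C_mul, e0, p1, mul_one, coeff_C_zero, coeff_C_succ,
      add_zero] at h2 h3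
    have h2 : b 1 = b' 1 := by linarith
    rw [h2] at h3
    exact ⟨h2.symm, by linarith⟩
  have h2 (n : ℕ) := eq_of_linear_combination (b := b' (n + 2)) (b' := b (n + 2))
    (c := c' (n + 2)) (c' := c (n + 2)) (d := d' (n + 2)) (d' := d (n + 2))
    (hP (n + 2)).1 (hP (n + 1)).1 (hP n).1 (hP (n + 2)).2
    (hP (n + 1)).2 (hP n).2 (by linear_combination (r2 n) - (r2' n))
  refine ⟨?_, ?_, ?_⟩ <;> funext n <;> match n with
  | 0 => first | exact hb0 | rw [c0, c0'] | rw [d0, d0']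
  | 1 => first | exact h1.1 | exact h1.2 | rw [d1, d1']
  | n + 2 => first | exact (h2 n).1 | exact (h2 n).2.1 | exact (h2 n).2.2

end Characterization

/-! ### Closed formulas for the coefficients -/

section Formulas

variable {a a₁ a₂ : ℝ}

lemma coeffB_two_mul (h₀ : -1 < a) (h₁ : -1 < a₁) (h₂ : -1 < a₂) (n : ℕ)
    (hn : 1 ≤ n ∨ bEvenDen a a₁ a₂ n ≠ 0) :
    coeffB a a₁ a₂ (2 * n) = bEvenNum a a₁ a₂ n / bEvenDen a a₁ a₂ n := by
  rcases n with _ | k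
  -- At `n = 0` factors such as `α₀ + α₁` may vanish, so the cancelled form of `b 0` is compared by
  -- cross-multiplication.
  · have hn := hn.resolve_left (by omega)
    have e : a + a₁ + 2 ≠ 0 := by linarith
    simp only [coeffB]
    rw [div_eq_div_iff e hn]
    simp only [bEvenNum, bEvenDen, Nat.cast_zero]
    ring
  · have hk : (0 : ℝ) ≤ k := k.cast_nonneg
    rw [show 2 * (k + 1) = 2 * k + 2 by ring, coeffB]
    simp only [node_two_mul, node_two_mul_add_one]
    push_cast
    rw [div_sub_div]
    · congr 1
      · simp only [bEvenNum]; ring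
      · simp only [bEvenDen]; ring
    · exact mul_ne_zero (by linarith) (by linarith)
    · exact mul_ne_zero (by linarith) (by linarith)

lemma coeffB_two_mul_add_one (h₀ : -1 < a) (h₁ : -1 < a₁) (h₂ : -1 < a₂) (n : ℕ)
    (hn : 1 ≤ n ∨ bOddDen a a₁ a₂ n ≠ 0) :
    coeffB a a₁ a₂ (2 * n + 1) = bOddNum a a₁ a₂ n / bOddDen a a₁ a₂ n := by
  rcases n with _ | k
  · have hn := hn.resolve_left (by omega)
    have e1 : a + a₁ + 2 ≠ 0 := by linarith
    have e2 : a + a₁ + 3 ≠ 0 := by linarith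
    have e3 : a + a₂ + 3 ≠ 0 := by linarith
    simp only [coeffB]
    rw [div_sub_div _ _ (mul_ne_zero e2 e3) e1,
      div_eq_div_iff (mul_ne_zero (mul_ne_zero e2 e3) e1) hn]
    simp only [bOddNum, bOddDen, Nat.cast_zero]
    ring
  · have hk : (0 : ℝ) ≤ k := k.cast_nonneg
    rw [show 2 * (k + 1) + 1 = 2 * k + 1 + 2 by ring, coeffB]
    rw [show 2 * k + 1 + 1 = 2 * (k + 1) by ring]
    simp only [node_two_mul, node_two_mul_add_one]
    push_cast
    rw [div_sub_div]
    · congr 1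
      · simp only [bOddNum]; ring
      · simp only [bOddDen]; ring
    · exact mul_ne_zero (by linarith) (by linarith)
    · exact mul_ne_zero (by linarith) (by linarith)

/-- With `x = p + w`, `y = q + w`, `δ = q - p` and `F`, `G` the values of `shiftCubic` at `q` and
`p`, the left side is `coeffC`. The hypothesis exhibits the divided difference as a polynomial `K`,
which is why `α₁ - α₂` does not appear in the denominators of `c_n`. -/
lemma div_mul_sub_div_div {W x y F G δ K : ℝ} (hx : 0 < x) (hy : 0 < y) (hδ : δ ≠ 0)
    (h : F * (x * (x + 1) * (x + 2)) - G * (y * (y + 1) * (y + 2)) = δ * K) :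
    W / (y * (x + 1) * (y + 1)) *
      ((F / ((y + 1) * (y + 2)) - G * y / (x * (x + 1) * (x + 2))) / δ) =
    W * K / (y * (y + 1) ^ 2 * (y + 2) * (x * (x + 1) ^ 2 * (x + 2))) := by
  have : F / ((y + 1) * (y + 2)) - G * y / (x * (x + 1) * (x + 2)) =
      δ * K / ((y + 1) * (y + 2) * (x * (x + 1) * (x + 2))) := by
    rw [div_sub_div _ _ (by positivity) (by positivity), ← h]
    congr 1; ring
  rw [this]
  field_simp

/-- The factor of degree four of `cEvenNum`. -/
def cEvenFactor (α₀ α₁ α₂ n : ℝ) : ℝ :=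
  54*n^4 + (63*α₀ + 45*α₁ + 45*α₂)*n^3 + (24*α₀^2 + 8*α₁^2 + 8*α₂^2 + 42*α₀*α₁ + 42*α₀*α₂ +
    44*α₁*α₂ - 8)*n^2 + (3*α₀^3 + α₁^3 + α₂^3 + 12*α₀^2*α₁ + 12*α₀^2*α₂ + 3*α₀*α₁^2 + 3*α₀*α₂^2
    + 33*α₀*α₁*α₂ + 8*α₁^2*α₂ + 8*α₁*α₂^2 - 3*α₀ - 4*α₁ - 4*α₂)*n + α₀^3*α₁ + α₀^3*α₂ +
    6*α₀^2*α₁*α₂ + α₁^3*α₂ + α₁*α₂^3 + 3*α₀*α₁^2*α₂ + 3*α₀*α₁*α₂^2 - α₀*α₁ - α₀*α₂ - 2*α₁*α₂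

lemma cEvenNum_eq (a a₁ a₂ n : ℝ) : cEvenNum a a₁ a₂ n =
    n * (2 * n + a) * (2 * n + a + a₁) * (2 * n + a + a₂) * cEvenFactor a a₁ a₂ n := rfl

/-- The factor of degree five of `cOddNum`. -/
def cOddFactor (α₀ α₁ α₂ n : ℝ) : ℝ :=
  54*n^5 + (63*α₀ + 45*α₁ + 45*α₂ + 135)*n^4 + (24*α₀^2 + 8*α₁^2 + 8*α₂^2 + 42*α₀*α₁ + 42*α₀*α₂
    + 44*α₁*α₂ + 126*α₀ + 76*α₁ + 104*α₂ + 120)*n^3 + (3*α₀^3 + α₁^3 + α₂^3 + 12*α₀^2*α₁ +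
    12*α₀^2*α₂ + 3*α₀*α₁^2 + 3*α₀*α₂^2 + 33*α₀*α₁*α₂ + 8*α₁^2*α₂ + 8*α₁*α₂^2 + 36*α₀^2 + 5*α₁^2
    + 19*α₂^2 + 54*α₀*α₁ + 72*α₀*α₂ + 66*α₁*α₂ + 87*α₀ + 39*α₁ + 81*α₂ + 45)*n^2 + (α₀^3*α₁ +
    α₀^3*α₂ + 6*α₀^2*α₁*α₂ + α₁^3*α₂ + α₁*α₂^3 + 3*α₀*α₁^2*α₂ + 3*α₀*α₁*α₂^2 + 3*α₀^3 + 2*α₂^3 +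
    12*α₀^2*α₁ + 12*α₀^2*α₂ + 6*α₀*α₂^2 + 33*α₀*α₁*α₂ + 5*α₁^2*α₂ + 11*α₁*α₂^2 + 18*α₀^2 +
    20*α₀*α₁ + 38*α₀*α₂ + 14*α₂^2 + 26*α₁*α₂ + 24*α₀ + 6*α₁ + 24*α₂ + 6)*n + α₀^3*α₁ +
    3*α₀^2*α₁*α₂ + 3*α₀*α₁*α₂^2 + α₁*α₂^3 + α₀^3 + α₂^3 + 3*α₀^2*α₁ + 3*α₀^2*α₂ + 6*α₀*α₁*α₂ +
    3*α₀*α₂^2 + 3*α₁*α₂^2 + 3*α₀^2 + 3*α₂^2 + 2*α₀*α₁ + 6*α₀*α₂ + 2*α₁*α₂ + 2*α₀ + 2*α₂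

lemma cOddNum_eq (a a₁ a₂ n : ℝ) : cOddNum a a₁ a₂ n =
    (2 * n + a + 1) * (2 * n + a + a₁ + 1) * (2 * n + a + a₂ + 1) * cOddFactor a a₁ a₂ n := rfl

lemma coeffC_two_mul (h₀ : -1 < a) (h₁ : -1 < a₁) (h₂ : -1 < a₂) (h₁₂ : ∀ z : ℤ, a₁ - a₂ ≠ z)
    (n : ℕ) :
    coeffC a a₁ a₂ (2 * n) = cEvenNum a a₁ a₂ n / cEvenDen a a₁ a₂ n := by
  rcases n with _ | k
  · simp [coeffC, cEvenNum]
  · have hk : (0 : ℝ) ≤ k := k.cast_nonneg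
    have hδ : a₂ + k - (a₁ + k) ≠ 0 := fun h => h₁₂ 0 (by push_cast; linarith)
    have key := div_mul_sub_div_div
      (W := (a + 2 * k + 2) * (a + 2 * k + 2 + a₁) * (a + 2 * k + 2 + a₂))
      (x := a₁ + k + (a + 2 * k + 2)) (y := a₂ + k + (a + 2 * k + 2))
      (F := shiftCubic a₁ a₂ (a₂ + k)) (G := shiftCubic a₁ a₂ (a₁ + k)) 
      (δ := a₂ + k - (a₁ + k))
      -- Both cubic values contain the factor `k + 1`; it becomes the factor `n` of `cEvenNum`,
      -- which has no analogue for odd indices.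
      (K := (k + 1) * cEvenFactor a a₁ a₂ (k + 1)) (by linarith) (by linarith) hδ
      (by
        obtain ⟨m, hm⟩ : ∃ m : ℝ, (k : ℝ) = m - 1 := ⟨k + 1, by ring⟩
        rw [hm]
        simp only [shiftCubic, sub_add_cancel, cEvenFactor]
        ring)
    rw [show 2 * (k + 1) = 2 * k + 2 by ring, coeffC, leadRatio,
      show 2 * k + 2 = 2 * (k + 1) by ring]
    simp only [node_two_mul, node_two_mul_add_one]
    push_cast
    rw [cEvenNum_eq, cEvenDen]
    convert! key using 2
    · congr 1; ring
    · ring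
    · ring

lemma coeffC_two_mul_add_one (h₀ : -1 < a) (h₁ : -1 < a₁) (h₂ : -1 < a₂)
    (h₁₂ : ∀ z : ℤ, a₁ - a₂ ≠ z) (n : ℕ) (hn : 1 ≤ n ∨ cOddDen a a₁ a₂ n ≠ 0) :
    coeffC a a₁ a₂ (2 * n + 1) = cOddNum a a₁ a₂ n / cOddDen a a₁ a₂ n := by
  rcases n with _ | k
  · have hn := hn.resolve_left (by omega)
    have e1 : a + a₁ + 2 ≠ 0 := by linarith
    have e2 : a + a₁ + 3 ≠ 0 := by linarith
    simp only [coeffC]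
    rw [div_eq_div_iff (mul_ne_zero (pow_ne_zero 2 e1) e2) hn]
    simp only [cOddNum, cOddDen, Nat.cast_zero]
    clear hn e1 e2 h₀ h₁ h₂ h₁₂
    -- With `u = a + a₁` and `v = a + a₂` as variables, the linear factors are short and the
    -- expansion stays manageable.
    obtain ⟨u, rfl⟩ : ∃ u, a₁ = u - a := ⟨a₁ + a, by ring⟩
    obtain ⟨v, rfl⟩ : ∃ v, a₂ = v - a := ⟨a₂ + a, by ring⟩
    ring
  · have hk : (0 : ℝ) ≤ k := k.cast_nonneg
    have hδ : a₁ + (k + 1) - (a₂ + k) ≠ 0 := fun h => h₁₂ (-1) (by push_cast; linarith)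
    have key := div_mul_sub_div_div
      (W := (a + (2 * k + 1) + 2) * (a + (2 * k + 1) + 2 + a₁) * (a + (2 * k + 1) + 2 + a₂))
      (x := a₂ + k + (a + (2 * k + 1) + 2)) (y := a₁ + (k + 1) + (a + (2 * k + 1) + 2))
      (F := shiftCubic a₁ a₂ (a₁ + (k + 1))) (G := shiftCubic a₁ a₂ (a₂ + k))
      (δ := a₁ + (k + 1) - (a₂ + k))
      (K := cOddFactor a a₁ a₂ (k + 1)) (by linarith) (by linarith) hδ
      (by
        obtain ⟨m, hm⟩ : ∃ m : ℝ, (k : ℝ) = m - 1 := ⟨k + 1, by ring⟩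
        rw [hm]
        simp only [shiftCubic, sub_add_cancel, cOddFactor]
        ring)
    rw [show 2 * (k + 1) + 1 = 2 * k + 1 + 2 by ring, coeffC, leadRatio,
      show 2 * k + 1 + 1 = 2 * (k + 1) by ring, show 2 * k + 1 + 2 = 2 * (k + 1) + 1 by ring]
    simp only [node_two_mul, node_two_mul_add_one]
    push_cast
    rw [cOddNum_eq, cOddDen]
    convert! key using 2
    · congr 1; ring
    · ring
    · ring

lemma coeffD_two (h₀ : -1 < a) (h₁ : -1 < a₁) (h₂ : -1 < a₂) :
    coeffD a a₁ a₂ 2 = (a + 1) * (a + 2) * (a₁ + 1) * (a₁ - a₂ + 1) /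
      ((a + a₁ + 2) * (a + a₁ + 3) ^ 2 * (a + a₁ + 4) * (a + a₂ + 3)) := by
  have e1 : a + a₁ + 2 ≠ 0 := by linarith
  have e2 : a + a₁ + 3 ≠ 0 := by linarith
  have e3 : a + a₁ + 4 ≠ 0 := by linarith
  have e4 : a + a₂ + 2 ≠ 0 := by linarith
  have e5 : a + a₂ + 3 ≠ 0 := by linarith
  simp only [coeffD, leadRatio, node, shiftCubic, Nat.cast_zero, add_zero]
  rw [show a₂ + (a + 2) = a + a₂ + 2 by ring, show a₁ + 1 + (a + 2) = a + a₁ + 3 by ring,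
    show a₂ + (a + 3) = a + a₂ + 3 by ring, show a₁ + (a + 2) = a + a₁ + 2 by ring,
    show a + a₁ + 2 + 1 = a + a₁ + 3 by ring, show a + a₁ + 2 + 2 = a + a₁ + 4 by ring]
  field_simp
  ring

/-- The factors `n (n + α₁) (n + α₁ - α₂)` are the value of `shiftCubic` at the node `α₁ + n - 1`;
the other six factors of the numerator come from two consecutive values of `leadRatio`. The case `n
= 1` is separate because `3n - 2 + α₀ + α₁` can then vanish. -/
lemma coeffD_two_mul (h₀ : -1 < a) (h₁ : -1 < a₁) (h₂ : -1 < a₂) (n : ℕ)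
    (hn : 2 ≤ n ∨ dEvenDen a a₁ a₂ n ≠ 0) :
    coeffD a a₁ a₂ (2 * n) = dEvenNum a a₁ a₂ n / dEvenDen a a₁ a₂ n := by
  match n with
  | 0 => simp [coeffD, dEvenNum]
  | 1 =>
    have hn := hn.resolve_left (by omega)
    have e1 : a + a₁ + 2 ≠ 0 := by linarith
    have e2 : a + a₁ + 3 ≠ 0 := by linarith
    have e3 : a + a₁ + 4 ≠ 0 := by linarith
    have e4 : a + a₂ + 3 ≠ 0 := by linarith
    rw [mul_one, coeffD_two h₀ h₁ h₂, div_eq_div_iff (by positivity) hn]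
    simp only [dEvenNum, dEvenDen, Nat.cast_one]
    clear hn e1 e2 e3 e4 h₀ h₁ h₂
    obtain ⟨u, rfl⟩ : ∃ u, a₁ = u - a := ⟨a₁ + a, by ring⟩
    obtain ⟨v, rfl⟩ : ∃ v, a₂ = v - a := ⟨a₂ + a, by ring⟩
    ring
  | k + 2 =>
    rw [show 2 * (k + 2) = 2 * k + 1 + 1 + 2 by ring, coeffD, leadRatio, leadRatio,
      show 2 * k + 1 + 1 + 1 = 2 * (k + 1) + 1 by ring,
      show 2 * k + 2 + 2 = 2 * (k + 2) by ring, show 2 * k + 1 + 1 = 2 * (k + 1) by ring]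
    simp only [node_two_mul, node_two_mul_add_one]
    push_cast
    rw [div_mul_div_comm, div_mul_div_comm]
    congr 1
    · simp only [shiftCubic, dEvenNum]
      obtain ⟨w, rfl⟩ : ∃ w, a = w - 2 * (k + 2) := ⟨a + 2 * (k + 2), by ring⟩
      obtain ⟨x, rfl⟩ : ∃ x, a₁ = x - w := ⟨a₁ + w, by ring⟩
      obtain ⟨y, rfl⟩ : ∃ y, a₂ = y - w := ⟨a₂ + w, by ring⟩
      ring
    · simp only [dEvenDen]
      obtain ⟨u, rfl⟩ : ∃ u, a₁ = u - a - 3 * (k + 2) := ⟨a₁ + a + 3 * (k + 2), by ring⟩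
      obtain ⟨v, rfl⟩ : ∃ v, a₂ = v - a - 3 * (k + 2) := ⟨a₂ + a + 3 * (k + 2), by ring⟩
      ring

lemma coeffD_two_mul_add_one (a a₁ a₂ : ℝ) (n : ℕ) :
    coeffD a a₁ a₂ (2 * n + 1) = dOddNum a a₁ a₂ n / dOddDen a a₁ a₂ n := by
  match n with
  | 0 => simp [coeffD, dOddNum]
  | k + 1 =>
    rw [show 2 * (k + 1) + 1 = 2 * k + 1 + 2 by ring, coeffD, leadRatio, leadRatio,
      show 2 * k + 1 + 2 = 2 * (k + 1) + 1 by ring, show 2 * k + 2 = 2 * (k + 1) by ring]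
    simp only [node_two_mul, node_two_mul_add_one]
    push_cast
    rw [div_mul_div_comm, div_mul_div_comm]
    congr 1
    · simp only [shiftCubic, dOddNum]
      obtain ⟨w, rfl⟩ : ∃ w, a = w - 2 * (k + 1) := ⟨a + 2 * (k + 1), by ring⟩
      obtain ⟨x, rfl⟩ : ∃ x, a₁ = x - w := ⟨a₁ + w, by ring⟩
      obtain ⟨y, rfl⟩ : ∃ y, a₂ = y - w := ⟨a₂ + w, by ring⟩
      ring
    · simp only [dOddDen]
      obtain ⟨u, rfl⟩ : ∃ u, a₁ = u - a - 3 * (k + 1) := ⟨a₁ + a + 3 * (k + 1), by ring⟩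
      obtain ⟨v, rfl⟩ : ∃ v, a₂ = v - a - 3 * (k + 1) := ⟨a₂ + a + 3 * (k + 1), by ring⟩
      ring

end Formulas

/-! ### Limits from leading coefficients -/

section Limits

open Filter Topology

/-- `f` is asymptotic to `L * x ^ k` at infinity (or `o(x ^ k)` when `L = 0`). -/
def Growth (f : ℝ → ℝ) (k : ℕ) (L : ℝ) : Prop :=
  Tendsto (fun x => f x / x ^ k) atTop (𝓝 L)

lemma growth_const_mul_pow (c : ℝ) (k : ℕ) : Growth (fun x => c * x ^ k) k c := by
  refine tendsto_const_nhds.congr' ?_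
  filter_upwards [eventually_gt_atTop 0] with x hx
  field_simp

lemma growth_const_mul (c : ℝ) : Growth (fun x => c * x) 1 c := by
  simpa using growth_const_mul_pow c 1

lemma growth_id : Growth (fun x => x) 1 1 := by
  simpa using growth_const_mul_pow 1 1

lemma Growth.mul {f g : ℝ → ℝ} {j k : ℕ} {L M : ℝ} (hf : Growth f j L) (hg : Growth g k M) :
    Growth (fun x => f x * g x) (j + k) (L * M) := by
  refine (Tendsto.mul hf hg).congr fun x => ?_
  rw [div_mul_div_comm, pow_add]

lemma Growth.sq {f : ℝ → ℝ} {k : ℕ} {L : ℝ} (hf : Growth f k L) :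
    Growth (fun x => f x ^ 2) (k + k) (L * L) := by
  simpa only [pow_two] using hf.mul hf

lemma Growth.add {f g : ℝ → ℝ} {k : ℕ} {L M : ℝ} (hf : Growth f k L) (hg : Growth g k M) :
    Growth (fun x => f x + g x) k (L + M) := by
  refine (Tendsto.add hf hg).congr fun x => ?_
  rw [add_div]

lemma Growth.succ {f : ℝ → ℝ} {k : ℕ} {L : ℝ} (hf : Growth f k L) : Growth f (k + 1) 0 := by
  have := Tendsto.mul hf tendsto_inv_atTop_zero
  rw [mul_zero] at this
  refine this.congr fun x => ?_
  rw [pow_succ, ← div_eq_mul_inv, div_div]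

lemma Growth.add_lower {f g : ℝ → ℝ} {k : ℕ} {L M : ℝ} (hf : Growth f (k + 1) L)
    (hg : Growth g k M) : Growth (fun x => f x + g x) (k + 1) L := by
  simpa using hf.add hg.succ

lemma growth_const (c : ℝ) (k : ℕ) : Growth (fun _ => c) (k + 1) 0 := by
  induction k with
  | zero => simpa using (growth_const_mul_pow c 0).succ
  | succ k ih => exact ih.succ

lemma Growth.add_const {f : ℝ → ℝ} {k : ℕ} {L : ℝ} (hf : Growth f (k + 1) L) (c : ℝ) :
    Growth (fun x => f x + c) (k + 1) L := by
  simpa using hf.add (growth_const c k)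

lemma Growth.sub_const {f : ℝ → ℝ} {k : ℕ} {L : ℝ} (hf : Growth f (k + 1) L) (c : ℝ) :
    Growth (fun x => f x - c) (k + 1) L := by
  simpa only [sub_eq_add_neg] using hf.add_const (-c)

lemma growth_quartic (c₄ c₃ c₂ c₁ : ℝ) :
    Growth (fun x => c₄ * x ^ 4 + c₃ * x ^ 3 + c₂ * x ^ 2 + c₁ * x) 4 c₄ :=
  (((growth_const_mul_pow c₄ 4).add_lower (growth_const_mul_pow c₃ 3)).add_lower
    (growth_const_mul_pow c₂ 2).succ).add_lower (growth_const_mul c₁).succ.succ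

lemma growth_quintic (c₅ c₄ c₃ c₂ c₁ : ℝ) :
    Growth (fun x => c₅ * x ^ 5 + c₄ * x ^ 4 + c₃ * x ^ 3 + c₂ * x ^ 2 + c₁ * x) 5 c₅ :=
  ((((growth_const_mul_pow c₅ 5).add_lower (growth_const_mul_pow c₄ 4)).add_lower
    (growth_const_mul_pow c₃ 3).succ).add_lower (growth_const_mul_pow c₂ 2).succ.succ).add_lower
    (growth_const_mul c₁).succ.succ.succ

lemma Growth.congr_exponent {f : ℝ → ℝ} {j k : ℕ} {L M : ℝ} (hf : Growth f j L) (hk : j = k)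
    (hL : L = M) : Growth f k M := by
  rw [← hk, ← hL]; exact hf

lemma Growth.tendsto_div {f g : ℝ → ℝ} {k : ℕ} {L M : ℝ} (hf : Growth f k L) (hg : Growth g k M)
    (hM : M ≠ 0) : Tendsto (fun n : ℕ => f n / g n) atTop (𝓝 (L / M)) := by
  have : Tendsto (fun x : ℝ => f x / g x) atTop (𝓝 (L / M)) := by
    refine (Tendsto.div hf hg hM).congr' ?_
    filter_upwards [eventually_gt_atTop 0] with x hx
    exact div_div_div_cancel_right₀ (pow_ne_zero k hx.ne') _ _
  exact this.comp tendsto_natCast_atTop_atTop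

lemma tendsto_of_even_of_odd {f : ℕ → ℝ} {L : ℝ} (he : Tendsto (fun n => f (2 * n)) atTop (𝓝 L))
    (ho : Tendsto (fun n => f (2 * n + 1)) atTop (𝓝 L)) : Tendsto f atTop (𝓝 L) := by
  rw [Metric.tendsto_atTop] at he ho ⊢
  intro ε hε
  obtain ⟨M, hM⟩ := he ε hε
  obtain ⟨N, hN⟩ := ho ε hε
  refine ⟨2 * max M N + 1, fun n hn => ?_⟩
  obtain ⟨k, rfl | rfl⟩ := n.even_or_odd'
  · exact hM k (by omega)
  · exact hN k (by omega)

variable (a a₁ a₂ : ℝ)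

/-- Terms free of `n` are peeled off until a polynomial in `n` without constant term is left, whose
leading coefficient is read off. -/
lemma growth_bEvenNum : Growth (bEvenNum a a₁ a₂) 4 36 := by
  unfold bEvenNum
  with_reducible
    repeat first
      | refine Growth.add_const (k := 3) ?_ _
      | refine Growth.sub_const (k := 3) ?_ _
  exact growth_quartic _ _ _ _

lemma growth_bOddNum : Growth (bOddNum a a₁ a₂) 4 36 := by
  unfold bOddNum
  with_reducible
    repeat first
      | refine Growth.add_const (k := 3) ?_ _
      | refine Growth.sub_const (k := 3) ?_ _
  exact growth_quartic _ _ _ _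

lemma growth_cEvenFactor : Growth (cEvenFactor a a₁ a₂) 4 54 := by
  unfold cEvenFactor
  with_reducible
    repeat first
      | refine Growth.add_const (k := 3) ?_ _
      | refine Growth.sub_const (k := 3) ?_ _
  exact growth_quartic _ _ _ _

lemma growth_cOddFactor : Growth (cOddFactor a a₁ a₂) 5 54 := by
  unfold cOddFactor
  with_reducible
    repeat first
      | refine Growth.add_const (k := 4) ?_ _
      | refine Growth.sub_const (k := 4) ?_ _
  exact growth_quintic _ _ _ _ _

lemma growth_cEvenNum : Growth (cEvenNum a a₁ a₂) 8 432 := by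
  rw [funext (cEvenNum_eq a a₁ a₂)]
  apply Growth.congr_exponent
  · with_reducible
      repeat' first
        | exact growth_cEvenFactor _ _ _ | exact growth_const_mul _ | exact growth_id | apply Growth.add_const
        | apply Growth.sub_const | apply Growth.mul
  all_goals norm_num

lemma growth_cOddNum : Growth (cOddNum a a₁ a₂) 8 432 := by
  rw [funext (cOddNum_eq a a₁ a₂)]
  apply Growth.congr_exponent
  · with_reducible
      repeat' first
        | exact growth_cOddFactor _ _ _ | exact growth_const_mul _ | exact growth_id | apply Growth.add_const
        | apply Growth.sub_const | apply Growth.mul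
  all_goals norm_num

lemma growth_bEvenDen : Growth (bEvenDen a a₁ a₂) 4 81 := by
  unfold bEvenDen
  apply Growth.congr_exponent
  · with_reducible
      repeat' first
        | exact growth_const_mul _ | exact growth_id | apply Growth.add_const
        | apply Growth.sub_const | apply Growth.mul
  all_goals norm_num

lemma growth_bOddDen : Growth (bOddDen a a₁ a₂) 4 81 := by
  unfold bOddDen
  apply Growth.congr_exponent
  · with_reducible
      repeat' first
        | exact growth_const_mul _ | exact growth_id | apply Growth.add_const
        | apply Growth.sub_const | apply Growth.mul
  all_goals norm_num

lemma growth_cEvenDen : Growth (cEvenDen a a₁ a₂) 8 6561 := by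
  unfold cEvenDen
  apply Growth.congr_exponent
  · with_reducible
      repeat' first
        | exact growth_const_mul _ | exact growth_id | apply Growth.add_const
        | apply Growth.sub_const | apply Growth.mul | apply Growth.sq
  all_goals norm_num

lemma growth_cOddDen : Growth (cOddDen a a₁ a₂) 8 6561 := by
  unfold cOddDen
  apply Growth.congr_exponent
  · with_reducible
      repeat' first
        | exact growth_const_mul _ | exact growth_id | apply Growth.add_const
        | apply Growth.sub_const | apply Growth.mul | apply Growth.sq
  all_goals norm_num

lemma growth_dEvenNum : Growth (dEvenNum a a₁ a₂) 9 64 := by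
  unfold dEvenNum
  apply Growth.congr_exponent
  · with_reducible
      repeat' first
        | exact growth_const_mul _ | exact growth_id | apply Growth.add_const
        | apply Growth.sub_const | apply Growth.mul
  all_goals norm_num

lemma growth_dOddNum : Growth (dOddNum a a₁ a₂) 9 64 := by
  unfold dOddNum
  apply Growth.congr_exponent
  · with_reducible
      repeat' first
        | exact growth_const_mul _ | exact growth_id | apply Growth.add_const
        | apply Growth.sub_const | apply Growth.mul
  all_goals norm_num

lemma growth_dEvenDen : Growth (dEvenDen a a₁ a₂) 9 19683 := by
  unfold dEvenDen
  apply Growth.congr_exponent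
  · with_reducible
      repeat' first
        | exact growth_const_mul _ | exact growth_id | apply Growth.add_const
        | apply Growth.sub_const | apply Growth.mul | apply Growth.sq
  all_goals norm_num

lemma growth_dOddDen : Growth (dOddDen a a₁ a₂) 9 19683 := by
  unfold dOddDen
  apply Growth.congr_exponent
  · with_reducible
      repeat' first
        | exact growth_const_mul _ | exact growth_id | apply Growth.add_const
        | apply Growth.sub_const | apply Growth.mul | apply Growth.sq
  all_goals norm_num

variable {a a₁ a₂}

lemma tendsto_coeffB (h₀ : -1 < a) (h₁ : -1 < a₁) (h₂ : -1 < a₂) :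
    Tendsto (coeffB a a₁ a₂) atTop (𝓝 (4 / 9)) := by
  rw [show (4 / 9 : ℝ) = 36 / 81 by norm_num]
  refine tendsto_of_even_of_odd ?_ ?_
  · refine ((growth_bEvenNum a a₁ a₂).tendsto_div (growth_bEvenDen a a₁ a₂)
      (by norm_num)).congr' ?_
    filter_upwards [eventually_ge_atTop 1] with n hn
    exact (coeffB_two_mul h₀ h₁ h₂ n (Or.inl hn)).symm
  · refine ((growth_bOddNum a a₁ a₂).tendsto_div (growth_bOddDen a a₁ a₂) (by norm_num)).congr' ?_
    filter_upwards [eventually_ge_atTop 1] with n hn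
    exact (coeffB_two_mul_add_one h₀ h₁ h₂ n (Or.inl hn)).symm

lemma tendsto_coeffC (h₀ : -1 < a) (h₁ : -1 < a₁) (h₂ : -1 < a₂)
    (h₁₂ : ∀ z : ℤ, a₁ - a₂ ≠ z) : Tendsto (coeffC a a₁ a₂) atTop (𝓝 (16 / 243)) := by
  -- `432 = 2 ^ 3 * 54` and `6561 = 3 ^ 8` are the leading coefficients for both parities.
  rw [show (16 / 243 : ℝ) = 432 / 6561 by norm_num]
  refine tendsto_of_even_of_odd ?_ ?_
  · refine ((growth_cEvenNum a a₁ a₂).tendsto_div (growth_cEvenDen a a₁ a₂)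
      (by norm_num)).congr fun n => ?_
    exact (coeffC_two_mul h₀ h₁ h₂ h₁₂ n).symm
  · refine ((growth_cOddNum a a₁ a₂).tendsto_div (growth_cOddDen a a₁ a₂) (by norm_num)).congr' ?_
    filter_upwards [eventually_ge_atTop 1] with n hn
    exact (coeffC_two_mul_add_one h₀ h₁ h₂ h₁₂ n (Or.inl hn)).symm

lemma tendsto_coeffD (h₀ : -1 < a) (h₁ : -1 < a₁) (h₂ : -1 < a₂) :
    Tendsto (coeffD a a₁ a₂) atTop (𝓝 (64 / 19683)) := by
  refine tendsto_of_even_of_odd ?_ ?_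
  · refine ((growth_dEvenNum a a₁ a₂).tendsto_div (growth_dEvenDen a a₁ a₂)
      (by norm_num)).congr' ?_
    filter_upwards [eventually_ge_atTop 2] with n hn
    exact (coeffD_two_mul h₀ h₁ h₂ n (Or.inl hn)).symm
  · refine ((growth_dOddNum a a₁ a₂).tendsto_div (growth_dOddDen a a₁ a₂)
      (by norm_num)).congr fun n => ?_
    exact (coeffD_two_mul_add_one a a₁ a₂ n).symm

end Limits

end JacobiPineiro

theorem mainTheorem6 (α₀ α₁ α₂ : ℝ) (h₀ : -1 < α₀) (h₁ : -1 < α₁) (h₂ : -1 < α₂)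
    (h₁₂ : ∀ z : ℤ, α₁ - α₂ ≠ (z : ℝ)) :
    (∃! P : ℕ → Polynomial ℝ, JacobiPineiro.IsNearlyDiagonal α₀ α₁ α₂ P) ∧
    ∀ P : ℕ → Polynomial ℝ, JacobiPineiro.IsNearlyDiagonal α₀ α₁ α₂ P →
      ∃ b c d : ℕ → ℝ,
        JacobiPineiro.FourTermRecurrence P b c d ∧
        (∀ b' c' d' : ℕ → ℝ, JacobiPineiro.FourTermRecurrence P b' c' d' →
          b' = b ∧ c' = c ∧ d' = d) ∧
        (∀ n : ℕ, 1 ≤ n ∨ JacobiPineiro.bEvenDen α₀ α₁ α₂ n ≠ 0 →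
          b (2 * n) = JacobiPineiro.bEvenNum α₀ α₁ α₂ n / JacobiPineiro.bEvenDen α₀ α₁ α₂ n) ∧
        (∀ n : ℕ, 1 ≤ n ∨ JacobiPineiro.bOddDen α₀ α₁ α₂ n ≠ 0 →
          b (2 * n + 1) = JacobiPineiro.bOddNum α₀ α₁ α₂ n / JacobiPineiro.bOddDen α₀ α₁ α₂ n) ∧
        (∀ n : ℕ, 1 ≤ n ∨ JacobiPineiro.cEvenDen α₀ α₁ α₂ n ≠ 0 →
          c (2 * n) = JacobiPineiro.cEvenNum α₀ α₁ α₂ n / JacobiPineiro.cEvenDen α₀ α₁ α₂ n) ∧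
        (∀ n : ℕ, 1 ≤ n ∨ JacobiPineiro.cOddDen α₀ α₁ α₂ n ≠ 0 →
          c (2 * n + 1) = JacobiPineiro.cOddNum α₀ α₁ α₂ n / JacobiPineiro.cOddDen α₀ α₁ α₂ n) ∧
        (∀ n : ℕ, 2 ≤ n ∨ JacobiPineiro.dEvenDen α₀ α₁ α₂ n ≠ 0 →
          d (2 * n) = JacobiPineiro.dEvenNum α₀ α₁ α₂ n / JacobiPineiro.dEvenDen α₀ α₁ α₂ n) ∧
        (∀ n : ℕ, 1 ≤ n ∨ JacobiPineiro.dOddDen α₀ α₁ α₂ n ≠ 0 →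
          d (2 * n + 1) = JacobiPineiro.dOddNum α₀ α₁ α₂ n / JacobiPineiro.dOddDen α₀ α₁ α₂ n) ∧
        b 0 = (α₁ + 1) / (α₀ + α₁ + 2) ∧
        b 1 = ((α₁ + 1) * (α₀ + α₂ + 2) + (α₂ + 2) * (α₀ + α₁ + 3)) /
            ((α₀ + α₁ + 3) * (α₀ + α₂ + 3)) - (α₁ + 1) / (α₀ + α₁ + 2) ∧
        c 1 = (α₀ + 1) * (α₁ + 1) / ((α₀ + α₁ + 2) ^ 2 * (α₀ + α₁ + 3)) ∧
        d 2 = (α₀ + 1) * (α₀ + 2) * (α₁ + 1) * (α₁ - α₂ + 1) /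
            ((α₀ + α₁ + 2) * (α₀ + α₁ + 3) ^ 2 * (α₀ + α₁ + 4) * (α₀ + α₂ + 3)) ∧
        Filter.Tendsto b Filter.atTop (nhds (4 / 9)) ∧
        Filter.Tendsto c Filter.atTop (nhds (16 / 243)) ∧
        Filter.Tendsto d Filter.atTop (nhds (64 / 19683)) := by
  have hP := JacobiPineiro.isNearlyDiagonal_nearlyDiagonal h₀ h₁ h₂ h₁₂
  refine ⟨⟨_, hP, fun Q hQ => hQ.unique h₀ h₁ h₂ h₁₂ hP⟩, fun P hP' => ?_⟩
  -- By uniqueness, an arbitrary `P` is the sequence built from the recurrence, so every claim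
  -- concerns the explicit coefficients.
  obtain rfl := hP'.unique h₀ h₁ h₂ h₁₂ hP
  have hrec := JacobiPineiro.fourTermRecurrence_nearlyDiagonal α₀ α₁ α₂
  exact ⟨JacobiPineiro.coeffB α₀ α₁ α₂, JacobiPineiro.coeffC α₀ α₁ α₂,
    JacobiPineiro.coeffD α₀ α₁ α₂, hrec,
    fun _ _ _ h => hrec.unique (JacobiPineiro.nearlyDiagonal_monic_natDegree α₀ α₁ α₂) h,
    JacobiPineiro.coeffB_two_mul h₀ h₁ h₂, JacobiPineiro.coeffB_two_mul_add_one h₀ h₁ h₂,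
    fun n _ => JacobiPineiro.coeffC_two_mul h₀ h₁ h₂ h₁₂ n,
    JacobiPineiro.coeffC_two_mul_add_one h₀ h₁ h₂ h₁₂, JacobiPineiro.coeffD_two_mul h₀ h₁ h₂,
    fun n _ => JacobiPineiro.coeffD_two_mul_add_one α₀ α₁ α₂ n, rfl, rfl, rfl,
    JacobiPineiro.coeffD_two h₀ h₁ h₂, JacobiPineiro.tendsto_coeffB h₀ h₁ h₂,
    JacobiPineiro.tendsto_coeffC h₀ h₁ h₂ h₁₂, JacobiPineiro.tendsto_coeffD h₀ h₁ h₂⟩
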